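/- Let $T>0$, $a>0$ and $c\neq 0$ be real constants, let $\omega=2\pi/T$, and let $e:\mathbb R\to\mathbb R$ be continuous and $T$-periodic with $\int_0^T e(t)\,dt=0$. Assume $$a\,\frac{3^5}{5^5}<\omega^2,\qquad \frac{\sqrt{3T}\,\|e\|_{L^2[0,T]}}{|c|}<1,\qquad \|e\|_{L^2[0,T]}=\Big(\int_0^T e(t)^2\,dt\Big)^{1/2}.$$ Consider, for a real parameter $\mu$, the positive $T$-periodic classical solutions (i.e. $u\in C^2(\mathbb R)$, $u>0$, $u(t+T)=u(t)$) of $$u''(t)+c\,u'(t)+a\Big(\frac1{u^4(t)}-\frac1{u^3(t)}\Big)=\mu+e(t),\qquad t\in\mathbb R .$$ Then for every $\xi\in(0,\infty)$ there is exactly one pair $(u,\mu)$ such that $\mu\in\mathbb R$ and $u$ is a positive $T$-periodic solution for this $\mu$ with average $\frac1T\int_0^T u(t)\,dt=\xi$. Moreover there is a function $\varphi$, unique on $(0,\infty)$ and continuous there, such that the set of pairs $(\xi,\mu)$ for which the equation with parameter $\mu$ has a positive $T$-periodic solution of average $\xi$ is exactly the curve $\{(\xi,\varphi(\xi)):\xi\in(0,\infty)\}$.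 There is $\xi_0>0$ with $\varphi(\xi_0)<0$ such that $\varphi$ is strictly decreasing on $(0,\xi_0)$ and strictly increasing on $(\xi_0,\infty)$, so that $\varphi(\xi_0)$ is the minimum value of $\varphi$ on $(0,\infty)$. Finally, $\lim_{\xi\to0^+}\varphi(\xi)=\infty$ and $\lim_{\xi\to\infty}\varphi(\xi)=0$. -/

import Mathlib

/-- `u` is a positive `T`-periodic classical (that is, twice continuously differentiable) solution
of `u'' + c u' + a (u⁻⁴ - u⁻³) = μ + e(t)` on the whole real line. -/
structure IsPositivePeriodicSolution (T c a : ℝ) (e : ℝ → ℝ) (μ : ℝ) (u : ℝ → ℝ) : Prop where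
  contDiff : ContDiff ℝ 2 u
  periodic : Function.Periodic u T
  pos : ∀ t, 0 < u t
  equation : ∀ t, deriv (deriv u) t + c * deriv u t + a * (1 / u t ^ 4 - 1 / u t ^ 3) = μ + e t

/-- The average of `u` over `[0, T]`. -/
noncomputable def periodAverage (T : ℝ) (u : ℝ → ℝ) : ℝ :=
  (1 / T) * ∫ t in (0 : ℝ)..T, u t

/-- The norm of a continuous function `e` in `L²[0, T]`. -/
noncomputable def normL2 (T : ℝ) (e : ℝ → ℝ) : ℝ :=
  Real.sqrt (∫ t in (0 : ℝ)..T, e t ^ 2)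

/-- The set of all pairs `(ξ, μ)` such that the equation with parameter `μ` has a positive
`T`-periodic solution of average `ξ`. -/
def solutionCurve (T c a : ℝ) (e : ℝ → ℝ) : Set (ℝ × ℝ) :=
  {p | ∃ u : ℝ → ℝ, IsPositivePeriodicSolution T c a e p.2 u ∧ periodAverage T u = p.1}

/-! Write F(x) = a (x⁻⁴ - x⁻³). The average ξ is prescribed and μ is left free, so that differences
of solutions with equal average have mean zero. Since F' ≤ a 3⁵/5⁵ < ω², testing such a difference
against itself removes both the damping term and the constant μ₁ - μ₂, and Wirtinger's inequality
absorbs the nonlinear term. This gives uniqueness for fixed ξ and Lipschitz dependence on the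
forcing (`abs_sub_le_of_abs_sub_le`), hence continuity of φ.

For existence F is frozen below a level δ, which makes it globally Lipschitz. The solvable linear
problem is then deformed into the nonlinear one by contraction steps of uniform size. Testing
against u - ξ bounds the integral of F(u) independently of δ; as F is strongly singular at 0, this
keeps u above δ when δ is small, and the freezing is inactive (`exists_forall_lt_of_truncated`).

For the shape of φ, Poincaré's inequality on half periods shows that distinct solutions with the
same μ are strictly ordered. F is strictly convex on (0, 5/3], which excludes three ordered
solutions there. F increases strictly on [4/3, ∞), and two solutions with the same μ have equal
averages of F, so the smaller one drops below 4/3 somewhere. The smallness of e makes its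
oscillation at most 1/√12 < 1/3 = 5/3 - 4/3. Hence φ takes no value at three points of which the two
largest are close (`not_exists_three`). With blow-up at 0 this makes φ strictly quasiconvex
(`lt_max_of_locally_not_three`); as φ is negative for large ξ and tends to 0, it has a negative
minimum and is strictly monotone on either side. Both limits come from averaging F(u). -/

open MeasureTheory Set Filter Topology intervalIntegral

/-! ### Poincaré, Wirtinger and oscillation inequalities. -/

/-- Poincaré's inequality with Dirichlet boundary conditions. -/
lemma sq_mul_integral_sq_le_of_zero {α β k : ℝ} (hαβ : α ≤ β) (hk : 0 ≤ k)
    (hk' : k * (β - α) < Real.pi) {w w' : ℝ → ℝ} (hw : ∀ t, HasDerivAt w (w' t) t)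
    (hw' : Continuous w') (hα : w α = 0) (hβ : w β = 0) :
    k ^ 2 * ∫ t in α..β, w t ^ 2 ≤ ∫ t in α..β, w' t ^ 2 := by
  have hwc : Continuous w := continuous_iff_continuousAt.2 fun t => (hw t).continuousAt
  set m := (α + β) / 2 with hm
  have hcos : ∀ t ∈ Icc α β, Real.cos (k * (t - m)) ≠ 0 := by
    intro t ht
    have h1 : k * (t - m) ≤ k * ((β - α) / 2) :=
      mul_le_mul_of_nonneg_left (by linarith [ht.2]) hk
    have h2 : k * (-((β - α) / 2)) ≤ k * (t - m) :=
      mul_le_mul_of_nonneg_left (by linarith [ht.1]) hk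
    exact (Real.cos_pos_of_mem_Ioo ⟨by linarith, by linarith⟩).ne'
  -- Picone's identity: D + w'² - k² w² = (w' + k tan(k(t - m)) w)². The tangent stays finite
  -- because k(β - α) < π, and D integrates to zero because w vanishes at both ends.
  set D : ℝ → ℝ := fun t => k * (1 / Real.cos (k * (t - m)) ^ 2 * k) * w t ^ 2
    + k * Real.tan (k * (t - m)) * (2 * w t * w' t) with hD
  have hderiv : ∀ t ∈ uIcc α β,
      HasDerivAt (fun t => k * Real.tan (k * (t - m)) * w t ^ 2) (D t) t := by
    intro t ht
    rw [uIcc_of_le hαβ] at ht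
    have h1 : HasDerivAt (fun t : ℝ => k * (t - m)) k t := by
      simpa using ((hasDerivAt_id t).sub_const m).const_mul k
    have h2 := ((Real.hasDerivAt_tan (hcos t ht)).comp t h1).const_mul k
    have h3 := h2.mul ((hw t).pow 2)
    refine h3.congr_deriv ?_
    simp [hD]
  have hDc : ContinuousOn D (uIcc α β) := by
    rw [uIcc_of_le hαβ]
    have h1 : ContinuousOn (fun t : ℝ => Real.cos (k * (t - m))) (Icc α β) := by fun_prop
    have h2 : ContinuousOn (fun t : ℝ => Real.tan (k * (t - m))) (Icc α β) := by
      simp only [Real.tan_eq_sin_div_cos]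
      exact ContinuousOn.div (by fun_prop) h1 hcos
    have h3 : ContinuousOn (fun t : ℝ => 1 / Real.cos (k * (t - m)) ^ 2) (Icc α β) :=
      ContinuousOn.div (by fun_prop) (h1.pow 2) fun t ht => pow_ne_zero 2 (hcos t ht)
    simp only [hD]
    fun_prop
  have hint := integral_eq_sub_of_hasDerivAt hderiv hDc.intervalIntegrable
  simp only [hα, hβ] at hint
  have hmono : ∫ t in α..β, (k ^ 2 * w t ^ 2 - w' t ^ 2) ≤ ∫ t in α..β, D t := by
    refine integral_mono_on hαβ (Continuous.intervalIntegrable (by fun_prop) _ _)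
      hDc.intervalIntegrable fun t ht => ?_
    have hc := hcos t ht
    have h1 : 1 / Real.cos (k * (t - m)) ^ 2 = 1 + Real.tan (k * (t - m)) ^ 2 := by
      rw [Real.tan_eq_sin_div_cos, div_pow, one_add_div (pow_ne_zero 2 hc), Real.cos_sq_add_sin_sq]
    simp only [hD, h1]
    nlinarith [sq_nonneg (w' t + k * Real.tan (k * (t - m)) * w t)]
  rw [integral_sub (Continuous.intervalIntegrable (by fun_prop) _ _)
    (Continuous.intervalIntegrable (by fun_prop) _ _), intervalIntegral.integral_const_mul] at hmono
  linarith

/-- Wirtinger's inequality for periodic functions of mean zero. -/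
lemma sq_mul_integral_sq_le_of_periodic {T k : ℝ} (hT : 0 < T) (hk : 0 ≤ k)
    (hk' : k * T < 2 * Real.pi) {w w' : ℝ → ℝ} (hw : ∀ t, HasDerivAt w (w' t) t)
    (hw' : Continuous w') (hp : Function.Periodic w T) (hp' : Function.Periodic w' T)
    (h0 : ∫ t in (0 : ℝ)..T, w t = 0) :
    k ^ 2 * ∫ t in (0 : ℝ)..T, w t ^ 2 ≤ ∫ t in (0 : ℝ)..T, w' t ^ 2 := by
  have hwc : Continuous w := continuous_iff_continuousAt.2 fun t => (hw t).continuousAt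
  -- The function w(t + T/2) - w(t) takes opposite values at 0 and T/2. At a zero t₀, the function w
  -- - w(t₀) vanishes at the ends of two consecutive half periods, where the Dirichlet inequality
  -- applies; mean zero makes the shift only increase the integral of the square.
  obtain ⟨t₀, ht₀⟩ : ∃ t₀, w (t₀ + T / 2) - w t₀ = 0 := by
    have hc : Continuous fun t => w (t + T / 2) - w t := by fun_prop
    have h1 : w (T / 2 + T / 2) = w 0 := by
      rw [add_halves]; simpa using hp 0
    rcases le_total (w (0 + T / 2) - w 0) 0 with h | h
    · exact mem_range_of_exists_le_of_exists_ge hc ⟨0, h⟩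
        ⟨T / 2, by rw [h1]; rw [zero_add] at h; linarith⟩
    · exact mem_range_of_exists_le_of_exists_ge hc
        ⟨T / 2, by rw [h1]; rw [zero_add] at h; linarith⟩ ⟨0, h⟩
  set d := w t₀ with hd
  have hz : ∀ t, HasDerivAt (fun t => w t - d) (w' t) t := fun t => (hw t).sub_const d
  have A := sq_mul_integral_sq_le_of_zero (α := t₀) (β := t₀ + T / 2) (k := k)
    (by linarith) hk (by linarith) hz hw' (by simp [hd]) (by simpa using ht₀)
  have B := sq_mul_integral_sq_le_of_zero (α := t₀ + T / 2) (β := t₀ + T) (k := k)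
    (by linarith) hk (by linarith) hz hw' (by simpa using ht₀) (by simp [hp t₀, hd])
  have i1 : ∀ α β, IntervalIntegrable (fun t => (w t - d) ^ 2) volume α β :=
    fun α β => Continuous.intervalIntegrable (by fun_prop) _ _
  have i2 : ∀ α β, IntervalIntegrable (fun t => w' t ^ 2) volume α β :=
    fun α β => Continuous.intervalIntegrable (by fun_prop) _ _
  have e1 := integral_add_adjacent_intervals (i1 t₀ (t₀ + T / 2)) (i1 (t₀ + T / 2) (t₀ + T))
  have e2 := integral_add_adjacent_intervals (i2 t₀ (t₀ + T / 2)) (i2 (t₀ + T / 2) (t₀ + T))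
  have p1 : Function.Periodic (fun t => (w t - d) ^ 2) T := fun t => by simp [hp t]
  have p2 : Function.Periodic (fun t => w' t ^ 2) T := fun t => by simp [hp' t]
  have q1 := p1.intervalIntegral_add_eq t₀ 0
  have q2 := p2.intervalIntegral_add_eq t₀ 0
  rw [zero_add] at q1 q2
  have hexp : ∫ t in (0 : ℝ)..T, (w t - d) ^ 2 = (∫ t in (0 : ℝ)..T, w t ^ 2) + T * d ^ 2 := by
    have : ∀ t, (w t - d) ^ 2 = w t ^ 2 - 2 * d * w t + d ^ 2 := fun t => by ring
    simp only [this]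
    rw [intervalIntegral.integral_add (Continuous.intervalIntegrable (by fun_prop) _ _)
      (Continuous.intervalIntegrable (by fun_prop) _ _),
      integral_sub (Continuous.intervalIntegrable (by fun_prop) _ _)
      (Continuous.intervalIntegrable (by fun_prop) _ _),
      intervalIntegral.integral_const_mul, h0]
    simp
  have : k ^ 2 * ∫ t in (0 : ℝ)..T, (w t - d) ^ 2 ≤ ∫ t in (0 : ℝ)..T, w' t ^ 2 := by
    rw [← q1, ← q2, ← e1, ← e2]; linarith
  rw [hexp] at this
  nlinarith [mul_nonneg (sq_nonneg k) (mul_nonneg hT.le (sq_nonneg d))]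

lemma sq_sub_le_mul_integral_deriv_sq {α β : ℝ} (hαβ : α ≤ β) {w w' : ℝ → ℝ}
    (hw : ∀ t, HasDerivAt w (w' t) t) (hw' : Continuous w') :
    (w β - w α) ^ 2 ≤ (β - α) * ∫ t in α..β, w' t ^ 2 := by
  rcases hαβ.eq_or_lt with rfl | hlt
  · simp
  have hFTC : ∫ t in α..β, w' t = w β - w α :=
    integral_eq_sub_of_hasDerivAt (fun t _ => hw t) (hw'.intervalIntegrable _ _)
  set d := w β - w α
  -- Cauchy–Schwarz against the constant function 1, by completing the square.
  have h0 : 0 ≤ ∫ t in α..β, ((β - α) * w' t - d) ^ 2 :=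
    integral_nonneg hαβ fun t _ => sq_nonneg _
  have hexp : ∫ t in α..β, ((β - α) * w' t - d) ^ 2
      = (β - α) * ((β - α) * (∫ t in α..β, w' t ^ 2) - d ^ 2) := by
    have : ∀ t, ((β - α) * w' t - d) ^ 2
        = (β - α) ^ 2 * w' t ^ 2 - 2 * d * (β - α) * w' t + d ^ 2 := fun t => by ring
    simp only [this]
    rw [intervalIntegral.integral_add (Continuous.intervalIntegrable (by fun_prop) _ _)
      (Continuous.intervalIntegrable (by fun_prop) _ _),
      integral_sub (Continuous.intervalIntegrable (by fun_prop) _ _)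
      (Continuous.intervalIntegrable (by fun_prop) _ _),
      intervalIntegral.integral_const_mul, intervalIntegral.integral_const_mul, hFTC]
    simp
    ring
  rw [hexp] at h0
  have := nonneg_of_mul_nonneg_right h0 (by linarith)
  linarith

/-- The oscillation of a periodic function is controlled by the `L²` norm of its derivative. -/
lemma sq_sub_le_of_periodic {T : ℝ} (hT : 0 < T) {w w' : ℝ → ℝ}
    (hw : ∀ t, HasDerivAt w (w' t) t) (hw' : Continuous w') (hp : Function.Periodic w T)
    (hp' : Function.Periodic w' T) (s t : ℝ) :
    (w s - w t) ^ 2 ≤ T / 4 * ∫ t in (0 : ℝ)..T, w' t ^ 2 := by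
  obtain ⟨r, hr, hr'⟩ := hp.exists_mem_Ico hT s t
  rw [hr']
  have A := sq_sub_le_mul_integral_deriv_sq hr.1 hw hw'
  have B := sq_sub_le_mul_integral_deriv_sq hr.2.le hw hw'
  rw [hp t] at B
  have i2 : ∀ α β, IntervalIntegrable (fun t => w' t ^ 2) volume α β :=
    fun α β => Continuous.intervalIntegrable (by fun_prop) _ _
  have p2 : Function.Periodic (fun t => w' t ^ 2) T := fun t => by simp [hp' t]
  have q2 := p2.intervalIntegral_add_eq t 0
  have e2 := integral_add_adjacent_intervals (i2 t r) (i2 r (t + T))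
  rw [zero_add, ← e2] at q2
  rw [← q2]
  set I := ∫ t in t..r, w' t ^ 2
  set J := ∫ t in r..(t + T), w' t ^ 2
  have hB : (w r - w t) ^ 2 ≤ (t + T - r) * J := by
    have : (w t - w r) ^ 2 = (w r - w t) ^ 2 := by ring
    rwa [this] at B
  set x := (w r - w t) ^ 2
  have hx : 0 ≤ x := sq_nonneg _
  have hl : 0 ≤ r - t := by linarith [hr.1]
  have hl' : 0 < t + T - r := by linarith [hr.2]
  have hJ : 0 ≤ J := integral_nonneg hr.2.le fun t _ => sq_nonneg _
  have hI : 0 ≤ I := integral_nonneg hr.1 fun t _ => sq_nonneg _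
  have h1 : x * x ≤ ((r - t) * I) * ((t + T - r) * J) :=
    mul_le_mul A hB hx (mul_nonneg hl hI)
  -- With arc lengths l + l' = T, the bounds x ≤ l I and x ≤ l' J give x² ≤ (l J)(l' I), so 2x ≤ l J
  -- + l' I by AM-GM. Adding all three yields 4x ≤ T(I + J), whence the factor T/4.
  have h2 : 2 * x ≤ (r - t) * J + (t + T - r) * I := by
    refine abs_le_of_sq_le_sq' ?_ (by positivity) |>.2
    nlinarith [sq_nonneg ((r - t) * J - (t + T - r) * I)]
  nlinarith

/-! ### Periodic solutions and energy estimates. -/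

/-- `u` is a `T`-periodic classical solution of `u'' + c u' + f(u) = h(t)`. -/
structure IsPeriodicSolution (T c : ℝ) (f h u : ℝ → ℝ) : Prop where
  contDiff : ContDiff ℝ 2 u
  periodic : Function.Periodic u T
  equation : ∀ t, deriv (deriv u) t + c * deriv u t + f (u t) = h t

namespace IsPeriodicSolution

variable {T c : ℝ} {f h u : ℝ → ℝ}

lemma hasDerivAt (hu : IsPeriodicSolution T c f h u) (t : ℝ) : HasDerivAt u (deriv u t) t :=
  (hu.contDiff.differentiable (by norm_num) t).hasDerivAt

lemma contDiff_deriv (hu : IsPeriodicSolution T c f h u) : ContDiff ℝ 1 (deriv u) :=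
  (contDiff_succ_iff_deriv.1 (show ContDiff ℝ (1 + 1) u by
    rw [one_add_one_eq_two]; exact hu.contDiff)).2.2

lemma hasDerivAt_deriv (hu : IsPeriodicSolution T c f h u) (t : ℝ) :
    HasDerivAt (deriv u) (deriv (deriv u) t) t :=
  (hu.contDiff_deriv.differentiable (by norm_num) t).hasDerivAt

lemma continuous (hu : IsPeriodicSolution T c f h u) : Continuous u := hu.contDiff.continuous

lemma continuous_deriv (hu : IsPeriodicSolution T c f h u) : Continuous (deriv u) :=
  hu.contDiff_deriv.continuous

lemma continuous_deriv_deriv (hu : IsPeriodicSolution T c f h u) :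
    Continuous (deriv (deriv u)) := (contDiff_one_iff_deriv.1 hu.contDiff_deriv).2

lemma periodic_deriv (hu : IsPeriodicSolution T c f h u) : Function.Periodic (deriv u) T := by
  intro t
  rw [← deriv_comp_add_const]
  congr 1
  exact funext hu.periodic

end IsPeriodicSolution

lemma periodAverage_sub {T : ℝ} {u v : ℝ → ℝ} (hu : Continuous u) (hv : Continuous v) :
    periodAverage T (fun t => u t - v t) = periodAverage T u - periodAverage T v := by
  simp only [periodAverage]
  rw [integral_sub (hu.intervalIntegrable _ _) (hv.intervalIntegrable _ _)]
  ring

lemma periodAverage_add_const {T : ℝ} (hT : 0 < T) {u : ℝ → ℝ} (hu : Continuous u) (d : ℝ) :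
    periodAverage T (fun t => u t + d) = periodAverage T u + d := by
  simp only [periodAverage]
  rw [intervalIntegral.integral_add (hu.intervalIntegrable _ _) (by simp)]
  simp
  field_simp

lemma integral_eq_mul_periodAverage {T : ℝ} (hT : 0 < T) (u : ℝ → ℝ) :
    ∫ t in (0 : ℝ)..T, u t = T * periodAverage T u := by
  simp only [periodAverage]
  field_simp

/-- Testing `w'' + c w'` against `w` on an interval. -/
lemma integral_mul_self_eq_neg_integral_sq {α β c : ℝ} {w w' w'' : ℝ → ℝ}
    (hw : ∀ t, HasDerivAt w (w' t) t) (hw' : ∀ t, HasDerivAt w' (w'' t) t)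
    (hw'' : Continuous w'') (hb : w β * w' β = w α * w' α) (hb' : w β ^ 2 = w α ^ 2) :
    ∫ t in α..β, (w'' t + c * w' t) * w t = -∫ t in α..β, w' t ^ 2 := by
  have hwc : Continuous w := continuous_iff_continuousAt.2 fun t => (hw t).continuousAt
  have hwc' : Continuous w' := continuous_iff_continuousAt.2 fun t => (hw' t).continuousAt
  have hd : ∀ t, HasDerivAt (fun t => w t * w' t + c / 2 * w t ^ 2)
      ((w'' t + c * w' t) * w t + w' t ^ 2) t := fun t => by
    refine (((hw t).mul (hw' t)).add (((hw t).pow 2).const_mul (c / 2))).congr_deriv ?_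
    norm_num
    ring
  have hint := integral_eq_sub_of_hasDerivAt (fun t (_ : t ∈ uIcc α β) => hd t)
    (Continuous.intervalIntegrable (by fun_prop) _ _)
  rw [intervalIntegral.integral_add (Continuous.intervalIntegrable (by fun_prop) _ _)
      (Continuous.intervalIntegrable (by fun_prop) _ _), hb, hb', sub_self] at hint
  linarith

lemma abs_sub_periodAverage_le {T : ℝ} (hT : 0 < T) {w w' : ℝ → ℝ}
    (hw : ∀ t, HasDerivAt w (w' t) t) (hw' : Continuous w') (hp : Function.Periodic w T)
    (hp' : Function.Periodic w' T) (t : ℝ) :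
    |w t - periodAverage T w| ≤ √(T / 4 * ∫ t in (0 : ℝ)..T, w' t ^ 2) := by
  have hwc : Continuous w := continuous_iff_continuousAt.2 fun t => (hw t).continuousAt
  set R := √(T / 4 * ∫ t in (0 : ℝ)..T, w' t ^ 2)
  have hosc : ∀ s, |w t - w s| ≤ R := fun s =>
    Real.abs_le_sqrt (sq_sub_le_of_periodic hT hw hw' hp hp' t s)
  have h1 : ∫ s in (0 : ℝ)..T, w s ≤ ∫ s in (0 : ℝ)..T, (w t + R) :=
    integral_mono_on hT.le (hwc.intervalIntegrable _ _) (by simp)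
      fun s _ => by linarith [(abs_le.1 (hosc s)).1]
  have h2 : ∫ s in (0 : ℝ)..T, (w t - R) ≤ ∫ s in (0 : ℝ)..T, w s :=
    integral_mono_on hT.le (by simp) (hwc.intervalIntegrable _ _)
      fun s _ => by linarith [(abs_le.1 (hosc s)).2]
  rw [integral_eq_mul_periodAverage hT w] at h1 h2
  simp only [intervalIntegral.integral_const, sub_zero, smul_eq_mul] at h1 h2
  have h3 := le_of_mul_le_mul_left h1 hT
  have h4 := le_of_mul_le_mul_left h2 hT
  rw [abs_le]
  constructor <;> linarith

namespace IsPeriodicSolution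

variable {T c : ℝ} {f h u : ℝ → ℝ}

/-- The `L²` bound for the derivative, obtained by testing the equation against `u'`. -/
lemma sq_mul_integral_deriv_sq_le (hT : 0 < T) (hf : Continuous f) {μ : ℝ} {e : ℝ → ℝ}
    (he : Continuous e) (hu : IsPeriodicSolution T c f (fun t => μ + e t) u) :
    c ^ 2 * ∫ t in (0 : ℝ)..T, deriv u t ^ 2 ≤ ∫ t in (0 : ℝ)..T, e t ^ 2 := by
  have c0 := hu.continuous
  have c1 := hu.continuous_deriv
  have c2 := hu.continuous_deriv_deriv
  have hu0 : u T = u 0 := by simpa using hu.periodic 0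
  have hu1 : deriv u T = deriv u 0 := by simpa using hu.periodic_deriv 0
  have h1 : ∫ t in (0 : ℝ)..T, deriv (deriv u) t * deriv u t = 0 := by
    have hd : ∀ t ∈ uIcc 0 T, HasDerivAt (fun t => deriv u t ^ 2 / 2)
        (deriv (deriv u) t * deriv u t) t := fun t _ => by
      refine (((hu.hasDerivAt_deriv t).pow 2).div_const 2).congr_deriv ?_
      norm_num
      ring
    rw [integral_eq_sub_of_hasDerivAt hd (Continuous.intervalIntegrable (by fun_prop) _ _), hu1,
      sub_self]
  have h2 : ∫ t in (0 : ℝ)..T, f (u t) * deriv u t = 0 := by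
    have := integral_comp_mul_deriv (a := 0) (b := T) (fun t _ => hu.hasDerivAt t)
      c1.continuousOn hf
    simpa [hu0] using this
  have h3 : ∫ t in (0 : ℝ)..T, deriv u t = 0 := by
    rw [integral_eq_sub_of_hasDerivAt (fun t _ => hu.hasDerivAt t) (c1.intervalIntegrable _ _),
      hu0, sub_self]
  -- Replacing e by the left side of the equation in the cross term leaves the integral of e² - c²
  -- u'², since u'' u', f(u) u' and u' all integrate to zero over a period.
  have h4 : 0 ≤ ∫ t in (0 : ℝ)..T, (c * deriv u t - e t) ^ 2 :=
    integral_nonneg hT.le fun t _ => sq_nonneg _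
  have h5 : ∀ t, (c * deriv u t - e t) ^ 2 = e t ^ 2 - c ^ 2 * deriv u t ^ 2
      - 2 * c * (deriv (deriv u) t * deriv u t) - 2 * c * (f (u t) * deriv u t)
      + 2 * c * μ * deriv u t := fun t => by
    have := hu.equation t
    have h6 : e t = deriv (deriv u) t + c * deriv u t + f (u t) - μ := by linarith
    rw [h6]
    ring
  simp only [h5] at h4
  rw [intervalIntegral.integral_add (Continuous.intervalIntegrable (by fun_prop) _ _)
      (Continuous.intervalIntegrable (by fun_prop) _ _),
    integral_sub (Continuous.intervalIntegrable (by fun_prop) _ _)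
      (Continuous.intervalIntegrable (by fun_prop) _ _),
    integral_sub (Continuous.intervalIntegrable (by fun_prop) _ _)
      (Continuous.intervalIntegrable (by fun_prop) _ _),
    integral_sub (Continuous.intervalIntegrable (by fun_prop) _ _)
      (Continuous.intervalIntegrable (by fun_prop) _ _),
    intervalIntegral.integral_const_mul, intervalIntegral.integral_const_mul,
    intervalIntegral.integral_const_mul, intervalIntegral.integral_const_mul, h1, h2, h3] at h4
  linarith

/-- Solutions with the same average depend Lipschitz continuously on the forcing term, modulo
constants. -/
lemma abs_sub_le_of_abs_sub_le {k K ε : ℝ} (hT : 0 < T) (hk : 0 ≤ k) (hkT : k * T < 2 * Real.pi)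
    (hK : 0 ≤ K) (hKk : K < k ^ 2)
    (hfK : ∀ x y, (f x - f y) * (x - y) ≤ K * (x - y) ^ 2) {μ₁ μ₂ : ℝ} {g₁ g₂ u₁ u₂ : ℝ → ℝ}
    (hε : ∀ t, |g₁ t - g₂ t| ≤ ε)
    (h₁ : IsPeriodicSolution T c f (fun t => μ₁ + g₁ t) u₁)
    (h₂ : IsPeriodicSolution T c f (fun t => μ₂ + g₂ t) u₂)
    (hav : periodAverage T u₁ = periodAverage T u₂) (t : ℝ) :
    |u₁ t - u₂ t| ≤ T ^ 2 / (4 * (1 - K / k ^ 2)) * ε := by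
  have hk2 : 0 < k ^ 2 := hK.trans_lt hKk
  have c1 := h₁.continuous
  have c2 := h₂.continuous
  have c3 := h₁.continuous_deriv
  have c4 := h₂.continuous_deriv
  have c5 := h₁.continuous_deriv_deriv
  have c6 := h₂.continuous_deriv_deriv
  set w : ℝ → ℝ := fun t => u₁ t - u₂ t with hw_def
  set w' : ℝ → ℝ := fun t => deriv u₁ t - deriv u₂ t with hw'_def
  have hw : ∀ t, HasDerivAt w (w' t) t := fun t => (h₁.hasDerivAt t).sub (h₂.hasDerivAt t)
  have hw' : ∀ t, HasDerivAt w' (deriv (deriv u₁) t - deriv (deriv u₂) t) t :=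
    fun t => (h₁.hasDerivAt_deriv t).sub (h₂.hasDerivAt_deriv t)
  have cw : Continuous w := by fun_prop
  have cw' : Continuous w' := by fun_prop
  have hp : Function.Periodic w T := fun t => by simp [w, h₁.periodic t, h₂.periodic t]
  have hp' : Function.Periodic w' T :=
    fun t => by simp [w', h₁.periodic_deriv t, h₂.periodic_deriv t]
  have hav0 : periodAverage T w = 0 := by rw [periodAverage_sub c1 c2, hav, sub_self]
  have hint0 : ∫ t in (0 : ℝ)..T, w t = 0 := by
    rw [integral_eq_mul_periodAverage hT, hav0, mul_zero]
  have hwT : w T = w 0 := by simpa using hp 0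
  have hwT' : w' T = w' 0 := by simpa using hp' 0
  set D := ∫ t in (0 : ℝ)..T, w' t ^ 2 with hD
  have hD0 : 0 ≤ D := integral_nonneg hT.le fun t _ => sq_nonneg _
  have hsup : ∀ t, |w t| ≤ √(T / 4 * D) := fun t => by
    simpa [hav0] using abs_sub_periodAverage_le hT hw cw' hp hp' t
  have htest := integral_mul_self_eq_neg_integral_sq (α := 0) (β := T) (c := c) hw hw'
    (by fun_prop) (by rw [hwT, hwT']) (by rw [hwT])
  have hwir := sq_mul_integral_sq_le_of_periodic hT hk hkT hw cw' hp hp' hint0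
  set R := √(T / 4 * D) with hR
  have hR0 : 0 ≤ R := Real.sqrt_nonneg _
  have hR2 : R ^ 2 = T / 4 * D := Real.sq_sqrt (by positivity)
  have hε0 : 0 ≤ ε := (abs_nonneg _).trans (hε 0)
  -- The term in μ₁ - μ₂ is kept because it integrates to zero. What remains is D ≤ K ∫w² + TεR;
  -- Wirtinger turns this into qD ≤ TεR, and R² = TD/4 then bounds R.
  have hle : ∫ t in (0 : ℝ)..T,
      ((μ₁ - μ₂) * w t - (K * w t ^ 2 + ε * R)) ≤ -D := by
    rw [← htest]
    refine integral_mono_on hT.le (Continuous.intervalIntegrable (by fun_prop) _ _)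
      (Continuous.intervalIntegrable (by fun_prop) _ _) fun t _ => ?_
    have e1 : deriv (deriv u₁) t - deriv (deriv u₂) t + c * w' t
        = (μ₁ - μ₂) + (g₁ t - g₂ t) - (f (u₁ t) - f (u₂ t)) := by
      have := h₁.equation t
      have := h₂.equation t
      simp only [w']
      linarith
    rw [e1]
    have e2 := hfK (u₁ t) (u₂ t)
    have e3 : |(g₁ t - g₂ t) * w t| ≤ ε * R := by
      rw [abs_mul]
      exact mul_le_mul (hε t) (hsup t) (abs_nonneg _) hε0
    have e4 := (abs_le.1 e3).1
    change (f (u₁ t) - f (u₂ t)) * w t ≤ K * w t ^ 2 at e2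
    linarith
  rw [integral_sub (Continuous.intervalIntegrable (by fun_prop) _ _)
      (Continuous.intervalIntegrable (by fun_prop) _ _),
    intervalIntegral.integral_add (Continuous.intervalIntegrable (by fun_prop) _ _)
      (Continuous.intervalIntegrable (by fun_prop) _ _),
    intervalIntegral.integral_const_mul, intervalIntegral.integral_const_mul, hint0] at hle
  simp only [intervalIntegral.integral_const, sub_zero, smul_eq_mul] at hle
  set I := ∫ t in (0 : ℝ)..T, w t ^ 2
  have hI : I ≤ D / k ^ 2 := by rw [le_div_iff₀ hk2]; linarith
  have hKI : K * I ≤ K / k ^ 2 * D := by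
    calc K * I ≤ K * (D / k ^ 2) := mul_le_mul_of_nonneg_left hI hK
      _ = _ := by ring
  set q := 1 - K / k ^ 2 with hq
  have hq0 : 0 < q := by rw [hq, sub_pos, div_lt_one hk2]; exact hKk
  have hfin : q * D ≤ T * ε * R := by rw [hq]; linarith
  have hRle : R ≤ T ^ 2 / (4 * q) * ε := by
    rcases hR0.eq_or_lt with h0 | h0
    · rw [← h0]; positivity
    · have : 4 * q * R * R ≤ T ^ 2 * ε * R := by nlinarith
      have := le_of_mul_le_mul_right this h0
      rw [div_mul_eq_mul_div, le_div_iff₀ (by positivity)]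
      linarith
  exact (hsup t).trans hRle

/-! ### Uniqueness and ordering of solutions of one equation. -/

lemma eq_of_eq_of_deriv_eq {L : NNReal} (hf : LipschitzWith L f) {u₁ u₂ : ℝ → ℝ}
    (h₁ : IsPeriodicSolution T c f h u₁) (h₂ : IsPeriodicSolution T c f h u₂) {t₀ : ℝ}
    (h0 : u₁ t₀ = u₂ t₀) (h0' : deriv u₁ t₀ = deriv u₂ t₀) : u₁ = u₂ := by
  let v : ℝ → ℝ × ℝ → ℝ × ℝ := fun t p => (p.2, h t - c * p.2 - f p.1)
  have key : ∀ u, IsPeriodicSolution T c f h u →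
      ∀ t, HasDerivAt (fun t => (u t, deriv u t)) (v t (u t, deriv u t)) t := fun u hu t => by
    have e : deriv (deriv u) t = h t - c * deriv u t - f (u t) := by linarith [hu.equation t]
    have := (hu.hasDerivAt t).prodMk (hu.hasDerivAt_deriv t)
    rwa [e] at this
  have hv : ∀ t, LipschitzOnWith (max 1 (0 + ‖c‖₊ * 1 + L * 1)) (v t) univ := fun t => by
    rw [lipschitzOnWith_univ]
    refine LipschitzWith.prodMk LipschitzWith.prod_snd ?_
    refine LipschitzWith.sub (LipschitzWith.sub (LipschitzWith.const _) ?_)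
      (hf.comp LipschitzWith.prod_fst)
    exact (lipschitzWith_smul c).comp LipschitzWith.prod_snd
  have := ODE_solution_unique_univ (v := v) (s := fun _ => univ) hv
    (fun t => ⟨key u₁ h₁ t, mem_univ _⟩) (fun t => ⟨key u₂ h₂ t, mem_univ _⟩)
    (t₀ := t₀) (by simp [h0, h0'])
  exact funext fun t => congrArg Prod.fst (congrFun this t)

/-- Two solutions of the same equation that agree at the ends of an interval of length at most
`T / 2` are equal. -/
lemma eq_of_eq_of_eq {L : NNReal} {k K : ℝ} (hk : 0 ≤ k) (hkT : k * T < 2 * Real.pi)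
    (hKk : K < k ^ 2) (hf : LipschitzWith L f)
    (hfK : ∀ x y, (f x - f y) * (x - y) ≤ K * (x - y) ^ 2) {u₁ u₂ : ℝ → ℝ}
    (h₁ : IsPeriodicSolution T c f h u₁) (h₂ : IsPeriodicSolution T c f h u₂) {α β : ℝ}
    (hαβ : α < β) (hβT : β - α ≤ T / 2) (hα : u₁ α = u₂ α) (hβ : u₁ β = u₂ β) : u₁ = u₂ := by
  have c1 := h₁.continuous
  have c2 := h₂.continuous
  have c3 := h₁.continuous_deriv
  have c4 := h₂.continuous_deriv
  have c5 := h₁.continuous_deriv_deriv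
  have c6 := h₂.continuous_deriv_deriv
  set w : ℝ → ℝ := fun t => u₁ t - u₂ t with hw_def
  set w' : ℝ → ℝ := fun t => deriv u₁ t - deriv u₂ t with hw'_def
  have hw : ∀ t, HasDerivAt w (w' t) t := fun t => (h₁.hasDerivAt t).sub (h₂.hasDerivAt t)
  have hw' : ∀ t, HasDerivAt w' (deriv (deriv u₁) t - deriv (deriv u₂) t) t :=
    fun t => (h₁.hasDerivAt_deriv t).sub (h₂.hasDerivAt_deriv t)
  have cw : Continuous w := by fun_prop
  have hwα : w α = 0 := sub_eq_zero.2 hα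
  have hwβ : w β = 0 := sub_eq_zero.2 hβ
  have htest := integral_mul_self_eq_neg_integral_sq (α := α) (β := β) (c := c) hw hw'
    (by fun_prop) (by rw [hwα, hwβ]; ring) (by rw [hwα, hwβ])
  -- An interval of length at most T/2 satisfies k(β - α) < π. Combined with the tested equation
  -- this gives k² ∫w² ≤ K ∫w² with K < k², so w vanishes on the interval and the Cauchy data agree
  -- at its midpoint.
  have hpoin := sq_mul_integral_sq_le_of_zero hαβ.le hk
    (by nlinarith [mul_le_mul_of_nonneg_left hβT hk]) hw (by fun_prop) hwα hwβ
  have hle : ∫ t in α..β, -(K * w t ^ 2) ≤ -∫ t in α..β, w' t ^ 2 := by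
    rw [← htest]
    refine integral_mono_on hαβ.le (Continuous.intervalIntegrable (by fun_prop) _ _)
      (Continuous.intervalIntegrable (by fun_prop) _ _) fun t _ => ?_
    have e1 : deriv (deriv u₁) t - deriv (deriv u₂) t + c * w' t
        = - (f (u₁ t) - f (u₂ t)) := by
      have := h₁.equation t
      have := h₂.equation t
      simp only [w']
      linarith
    have e2 := hfK (u₁ t) (u₂ t)
    change (f (u₁ t) - f (u₂ t)) * w t ≤ K * w t ^ 2 at e2
    rw [e1]
    linarith
  rw [intervalIntegral.integral_neg, intervalIntegral.integral_const_mul] at hle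
  set I := ∫ t in α..β, w t ^ 2 with hI
  have hI0 : I ≤ 0 := by
    by_contra! hpos
    nlinarith
  have hzero : ∀ t ∈ Icc α β, w t = 0 := by
    by_contra! hne
    obtain ⟨t, ht, hne⟩ := hne
    have : 0 < I := intervalIntegral.integral_pos hαβ (by fun_prop) (fun t _ => sq_nonneg _)
      ⟨t, ht, by positivity⟩
    linarith
  set m := (α + β) / 2 with hm
  have hmm : Icc α β ∈ 𝓝 m := Icc_mem_nhds (by linarith) (by linarith)
  have hev : w =ᶠ[𝓝 m] fun _ => 0 := by filter_upwards [hmm] with t ht using hzero t ht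
  have hd : w' m = 0 := by
    rw [← (hw m).deriv, hev.deriv_eq]
    simp
  exact eq_of_eq_of_deriv_eq hf h₁ h₂ (sub_eq_zero.1 (hzero m (mem_of_mem_nhds hmm)))
    (sub_eq_zero.1 hd)

/-- Distinct periodic solutions of the same equation are ordered. -/
lemma lt_of_periodAverage_lt {L : NNReal} {k K : ℝ} (hT : 0 < T) (hk : 0 ≤ k)
    (hkT : k * T < 2 * Real.pi)
    (hKk : K < k ^ 2) (hf : LipschitzWith L f)
    (hfK : ∀ x y, (f x - f y) * (x - y) ≤ K * (x - y) ^ 2) {u₁ u₂ : ℝ → ℝ}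
    (h₁ : IsPeriodicSolution T c f h u₁) (h₂ : IsPeriodicSolution T c f h u₂)
    (hav : periodAverage T u₁ < periodAverage T u₂) (t : ℝ) : u₁ t < u₂ t := by
  have c1 := h₁.continuous
  have c2 := h₂.continuous
  have hne : u₁ ≠ u₂ := fun h => by rw [h] at hav; exact lt_irrefl _ hav
  obtain ⟨t₁, ht₁⟩ : ∃ t₁, u₁ t₁ < u₂ t₁ := by
    by_contra! hle
    have := integral_mono_on (μ := volume) hT.le (c2.intervalIntegrable 0 T)
      (c1.intervalIntegrable 0 T)
      fun t _ => hle t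
    rw [integral_eq_mul_periodAverage hT, integral_eq_mul_periodAverage hT] at this
    exact absurd (le_of_mul_le_mul_left this hT) (not_le.2 hav)
  -- A contact at t₀ recurs at t₀ + T, and any contact in between lies within T/2 of one of the two.
  -- So u₂ - u₁ has one sign between them, t₀ is a minimum, and the contact is tangential, against
  -- Cauchy uniqueness.
  have hno : ∀ t₀, u₁ t₀ ≠ u₂ t₀ := by
    intro t₀ h0
    have hend : u₁ (t₀ + T) = u₂ (t₀ + T) := by rw [h₁.periodic, h₂.periodic, h0]
    have hin : ∀ s ∈ Ioo t₀ (t₀ + T), u₁ s ≠ u₂ s := by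
      intro s hs h0s
      rcases le_total s (t₀ + T / 2) with hle | hle
      · exact hne (eq_of_eq_of_eq hk hkT hKk hf hfK h₁ h₂ hs.1 (by linarith) h0 h0s)
      · exact hne (eq_of_eq_of_eq hk hkT hKk hf hfK h₁ h₂ hs.2 (by linarith) h0s hend)
    obtain ⟨s₁, hs₁, hs₁'⟩ : ∃ s ∈ Ico t₀ (t₀ + T), u₁ s < u₂ s := by
      have hp : Function.Periodic (fun t => u₂ t - u₁ t) T :=
        fun t => by simp [h₁.periodic t, h₂.periodic t]
      obtain ⟨s, hs, hs'⟩ := hp.exists_mem_Ico hT t₁ t₀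
      refine ⟨s, hs, ?_⟩
      linarith
    have hs₁'' : s₁ ∈ Ioo t₀ (t₀ + T) := by
      refine ⟨lt_of_le_of_ne hs₁.1 fun h => ?_, hs₁.2⟩
      rw [← h, h0] at hs₁'
      exact lt_irrefl _ hs₁'
    have hpos : ∀ s ∈ Ioo t₀ (t₀ + T), u₁ s < u₂ s := by
      intro s hs
      by_contra! hle
      obtain ⟨r, hr, hr'⟩ := isPreconnected_Ioo.intermediate_value hs₁'' hs
        (f := fun t => u₁ t - u₂ t) (by fun_prop)
        (show (0 : ℝ) ∈ Icc _ _ from ⟨by linarith, by linarith⟩)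
      exact hin r hr (sub_eq_zero.1 hr')
    have hnn : ∀ s, 0 ≤ u₂ s - u₁ s := by
      intro s
      have hp : Function.Periodic (fun t => u₂ t - u₁ t) T :=
        fun t => by simp [h₁.periodic t, h₂.periodic t]
      obtain ⟨r, hr, hr'⟩ := hp.exists_mem_Ico hT s t₀
      refine hr'.ge.trans' ?_
      rcases hr.1.eq_or_lt with h | h
      · rw [← h, h0, sub_self]
      · exact (sub_pos.2 (hpos r ⟨h, hr.2⟩)).le
    have hmin : IsLocalMin (fun t => u₂ t - u₁ t) t₀ :=
      Eventually.of_forall fun s => by simpa [h0] using hnn s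
    have hd := hmin.hasDerivAt_eq_zero ((h₂.hasDerivAt t₀).sub (h₁.hasDerivAt t₀))
    exact hne (eq_of_eq_of_deriv_eq hf h₁ h₂ h0 (sub_eq_zero.1 hd).symm)
  by_contra! hle
  obtain ⟨r, -, hr'⟩ := isPreconnected_univ.intermediate_value (mem_univ t₁) (mem_univ t)
    (f := fun t => u₁ t - u₂ t) (by fun_prop)
    (show (0 : ℝ) ∈ Icc _ _ from ⟨by linarith, by linarith⟩)
  exact hno r (sub_eq_zero.1 hr')

end IsPeriodicSolution

/-! ### The linear problem and the method of continuity. -/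

lemma periodic_integral_of_periodic {T : ℝ} {h : ℝ → ℝ} (hh : Continuous h)
    (hp : Function.Periodic h T) (h0 : ∫ t in (0 : ℝ)..T, h t = 0) :
    Function.Periodic (fun t => ∫ s in (0 : ℝ)..t, h s) T := fun t => by
  have h1 := integral_add_adjacent_intervals (hh.intervalIntegrable (μ := volume) 0 t)
    (hh.intervalIntegrable t (t + T))
  have h2 := hp.intervalIntegral_add_eq t 0
  rw [zero_add, h0] at h2
  simp only
  rw [← h1, h2, add_zero]

lemma hasDerivAt_integral_of_continuous {h : ℝ → ℝ} (hh : Continuous h) (a t : ℝ) :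
    HasDerivAt (fun t => ∫ s in a..t, h s) (h t) t :=
  integral_hasDerivAt_right (hh.intervalIntegrable _ _)
    hh.aestronglyMeasurable.stronglyMeasurableAtFilter hh.continuousAt

/-- Periodic solutions of a scalar linear first order equation. -/
lemma exists_periodic_hasDerivAt {T c : ℝ} (hT : 0 < T) (hc : c ≠ 0) {H : ℝ → ℝ}
    (hH : Continuous H) (hp : Function.Periodic H T) :
    ∃ v : ℝ → ℝ, Function.Periodic v T ∧ ∀ t, HasDerivAt v (H t - c * v t) t := by
  have hcont : Continuous fun s => Real.exp (c * s) * H s := by fun_prop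
  set G : ℝ → ℝ := fun t => ∫ s in (0 : ℝ)..t, Real.exp (c * s) * H s with hG
  have hne : Real.exp (c * T) - 1 ≠ 0 := by
    rw [sub_ne_zero, Ne, Real.exp_eq_one_iff]
    exact mul_ne_zero hc hT.ne'
  have hGT : ∀ t, G (t + T) = G T + Real.exp (c * T) * G t := fun t => by
    have h1 := integral_add_adjacent_intervals (hcont.intervalIntegrable (μ := volume) 0 T)
      (hcont.intervalIntegrable T (t + T))
    have h2 := intervalIntegral.integral_comp_add_right (a := 0) (b := t)
      (fun s => Real.exp (c * s) * H s) T
    rw [zero_add] at h2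
    simp only [hG]
    rw [← h1, ← h2, ← intervalIntegral.integral_const_mul]
    congr 1
    refine integral_congr fun s _ => ?_
    rw [hp s, mul_add, Real.exp_add]
    ring
  -- The initial value for which variation of constants returns to itself after time T; the
  -- denominator is nonzero because c ≠ 0.
  set v₀ := G T / (Real.exp (c * T) - 1) with hv₀
  refine ⟨fun t => Real.exp (-(c * t)) * (v₀ + G t), fun t => ?_, fun t => ?_⟩
  · have h1 : v₀ + G T = Real.exp (c * T) * v₀ := by
      rw [hv₀]
      field_simp
      ring
    simp only
    rw [hGT, ← add_assoc, h1, ← mul_add, ← mul_assoc, ← Real.exp_add]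
    congr 2
    ring
  · have h1 : HasDerivAt (fun t => Real.exp (-(c * t))) (Real.exp (-(c * t)) * (-(c * 1))) t :=
      (((hasDerivAt_id t).const_mul c).neg).exp
    have h2 : HasDerivAt (fun t => v₀ + G t) (Real.exp (c * t) * H t) t :=
      (hasDerivAt_integral_of_continuous hcont 0 t).const_add v₀
    refine (h1.mul h2).congr_deriv ?_
    have h3 : Real.exp (-(c * t)) * Real.exp (c * t) = 1 := by
      rw [← Real.exp_add]; simp
    linear_combination (H t) * h3

/-- The linear problem `u'' + c u' = μ + g` with prescribed average. -/
lemma exists_isPeriodicSolution_zero {T c : ℝ} (hT : 0 < T) (hc : c ≠ 0) (ξ : ℝ) {g : ℝ → ℝ}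
    (hg : Continuous g) (hp : Function.Periodic g T) :
    ∃ (μ : ℝ) (u : ℝ → ℝ), IsPeriodicSolution T c (fun _ => 0) (fun t => μ + g t) u ∧
      periodAverage T u = ξ := by
  -- This μ makes the right side mean zero, so its primitive H is periodic and u' + c u = H + const
  -- remains to be solved. Adding a constant to u changes only its average.
  set μ := -periodAverage T g with hμ
  have hh : Continuous fun t => μ + g t := by fun_prop
  have h0 : ∫ t in (0 : ℝ)..T, (μ + g t) = 0 := by
    rw [intervalIntegral.integral_add (by simp) (hg.intervalIntegrable _ _),
      integral_eq_mul_periodAverage hT g, hμ]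
    simp
  have hHp := periodic_integral_of_periodic hh (fun t => by simp [hp t]) h0
  have hHd := hasDerivAt_integral_of_continuous hh 0
  set H : ℝ → ℝ := fun t => ∫ s in (0 : ℝ)..t, (μ + g s)
  have hHc : Continuous H := continuous_iff_continuousAt.2 fun t => (hHd t).continuousAt
  obtain ⟨v, hvp, hvd⟩ := exists_periodic_hasDerivAt hT hc hHc hHp
  have hvc : Continuous v := continuous_iff_continuousAt.2 fun t => (hvd t).continuousAt
  set d := ξ - periodAverage T v
  have hu : ∀ t, HasDerivAt (fun t => v t + d) (H t - c * v t) t := fun t => (hvd t).add_const d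
  have hu' : ∀ t, HasDerivAt (fun t => H t - c * v t) (μ + g t - c * (H t - c * v t)) t :=
    fun t => (hHd t).sub ((hvd t).const_mul c)
  have e1 : deriv (fun t => v t + d) = fun t => H t - c * v t := funext fun t => (hu t).deriv
  have e2 : deriv (fun t => H t - c * v t) = fun t => μ + g t - c * (H t - c * v t) :=
    funext fun t => (hu' t).deriv
  refine ⟨μ, fun t => v t + d, ⟨?_, fun t => by simp [hvp t], fun t => ?_⟩, ?_⟩
  · rw [← one_add_one_eq_two, contDiff_succ_iff_deriv]
    refine ⟨fun t => (hu t).differentiableAt, by simp, ?_⟩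
    rw [e1, contDiff_one_iff_deriv, e2]
    exact ⟨fun t => (hu' t).differentiableAt, by fun_prop⟩
  · rw [e1, e2]
    ring
  · rw [periodAverage_add_const hT hvc]
    simp [d]

/-- One step of the method of continuity. -/
lemma exists_isPeriodicSolution_step {T c k K s η : ℝ} (hT : 0 < T) (hk : 0 ≤ k)
    (hkT : k * T < 2 * Real.pi) (hK : 0 ≤ K) (hKk : K < k ^ 2) {L : NNReal} {f : ℝ → ℝ}
    (hf : LipschitzWith L f) (hfK : ∀ x y, (f x - f y) * (x - y) ≤ K * (x - y) ^ 2) {ξ : ℝ}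
    (hs : 0 ≤ s) (hs1 : s ≤ 1) (hη : 0 ≤ η) (hηL : T ^ 2 / (4 * (1 - K / k ^ 2)) * η * L < 1)
    (H : ∀ g : ℝ → ℝ, Continuous g → Function.Periodic g T → ∃ (μ : ℝ) (u : ℝ → ℝ),
      IsPeriodicSolution T c (fun x => s * f x) (fun t => μ + g t) u ∧ periodAverage T u = ξ)
    {g : ℝ → ℝ} (hg : Continuous g) (hp : Function.Periodic g T) : ∃ (μ : ℝ) (u : ℝ → ℝ),
      IsPeriodicSolution T c (fun x => (s + η) * f x) (fun t => μ + g t) u ∧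
      periodAverage T u = ξ := by
  have : Fact (0 < T) := ⟨hT⟩
  have hq : 0 < 1 - K / k ^ 2 := by
    rw [sub_pos, div_lt_one (hK.trans_lt hKk)]; exact hKk
  set C := T ^ 2 / (4 * (1 - K / k ^ 2)) with hC
  have hC0 : 0 ≤ C := by positivity
  have hfc := hf.continuous
  have hmk : Continuous fun t : ℝ => (t : AddCircle T) := AddCircle.continuous_mk' T
  -- The extra term η f is evaluated at a given v, and v is sent to the solution of the s-problem.
  -- The Lipschitz estimate makes this a contraction with constant C η L on continuous functions on
  -- the circle.
  choose μ u hu hav using fun v : C(AddCircle T, ℝ) =>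
    H (fun t => g t - η * f (v t)) (by fun_prop) (fun t => by simp [hp t])
  have hsK : ∀ x y, (s * f x - s * f y) * (x - y) ≤ K * (x - y) ^ 2 := fun x y => by
    have h1 := mul_le_mul_of_nonneg_left (hfK x y) hs
    have h2 : s * (K * (x - y) ^ 2) ≤ 1 * (K * (x - y) ^ 2) :=
      mul_le_mul_of_nonneg_right hs1 (by positivity)
    linarith
  let Φ : C(AddCircle T, ℝ) → C(AddCircle T, ℝ) := fun v =>
    ⟨(hu v).periodic.lift, continuous_coinduced_dom.2 (hu v).continuous⟩
  have hΦ : ∀ v (t : ℝ), Φ v t = u v t := fun v t => (hu v).periodic.lift_coe t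
  have hcontr : ContractingWith (Real.toNNReal (C * η * L)) Φ := by
    refine ⟨by rw [← Real.toNNReal_one]; exact (Real.toNNReal_lt_toNNReal_iff one_pos).2 hηL,
      LipschitzWith.of_dist_le_mul fun v₁ v₂ => ?_⟩
    rw [Real.coe_toNNReal _ (by positivity), ContinuousMap.dist_le (by positivity)]
    intro x
    induction x using QuotientAddGroup.induction_on with
    | H t =>
      rw [hΦ, hΦ, Real.dist_eq]
      have := IsPeriodicSolution.abs_sub_le_of_abs_sub_le (ε := η * (L * dist v₁ v₂)) hT hk hkT hK
        hKk hsK (fun t => ?_) (hu v₁) (hu v₂) ((hav v₁).trans (hav v₂).symm) t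
      · linarith
      · have e : g t - η * f (v₁ t) - (g t - η * f (v₂ t)) = -(η * (f (v₁ t) - f (v₂ t))) := by
          ring
        rw [e, abs_neg, abs_mul, abs_of_nonneg hη]
        refine mul_le_mul_of_nonneg_left ?_ hη
        exact (hf.dist_le_mul _ _).trans
          (mul_le_mul_of_nonneg_left (ContinuousMap.dist_apply_le_dist _) L.2)
  set v := hcontr.fixedPoint
  have hv : Φ v = v := hcontr.fixedPoint_isFixedPt
  refine ⟨μ v, u v, ⟨(hu v).contDiff, (hu v).periodic, fun t => ?_⟩, hav v⟩
  have h1 := (hu v).equation t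
  have h2 : v t = u v t := by rw [← hΦ, hv]
  rw [h2] at h1
  linarith

/-- Existence of a periodic solution with prescribed average, for Lipschitz nonlinearities. -/
lemma exists_isPeriodicSolution {T c k K : ℝ} (hT : 0 < T) (hc : c ≠ 0) (hk : 0 ≤ k)
    (hkT : k * T < 2 * Real.pi) (hK : 0 ≤ K) (hKk : K < k ^ 2) {L : NNReal} {f : ℝ → ℝ}
    (hf : LipschitzWith L f) (hfK : ∀ x y, (f x - f y) * (x - y) ≤ K * (x - y) ^ 2) (ξ : ℝ)
    {g : ℝ → ℝ} (hg : Continuous g) (hp : Function.Periodic g T) : ∃ (μ : ℝ) (u : ℝ → ℝ),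
      IsPeriodicSolution T c f (fun t => μ + g t) u ∧ periodAverage T u = ξ := by
  -- The admissible step depends on T, k, K and L but not on s, so N steps of size 1/N reach s = 1.
  obtain ⟨N, hN⟩ := exists_nat_gt (T ^ 2 / (4 * (1 - K / k ^ 2)) * L)
  have hq : 0 < 1 - K / k ^ 2 := by
    rw [sub_pos, div_lt_one (hK.trans_lt hKk)]; exact hKk
  have hN0 : (0 : ℝ) < N := lt_of_le_of_lt (by positivity) hN
  have key : ∀ n : ℕ, n ≤ N → ∀ g : ℝ → ℝ, Continuous g → Function.Periodic g T →
      ∃ (μ : ℝ) (u : ℝ → ℝ), IsPeriodicSolution T c (fun x => (n / N : ℝ) * f x)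
        (fun t => μ + g t) u ∧ periodAverage T u = ξ := by
    intro n
    induction n with
    | zero =>
      intro _ g hg hp
      simpa using exists_isPeriodicSolution_zero hT hc ξ hg hp
    | succ n ih =>
      intro hn g hg hp
      have hn' : (n : ℝ) + 1 ≤ N := by exact_mod_cast hn
      have e : ((n + 1 : ℕ) / N : ℝ) = n / N + 1 / N := by push_cast; ring
      rw [e]
      refine exists_isPeriodicSolution_step hT hk hkT hK hKk hf hfK (by positivity)
        (by rw [div_le_one hN0]; linarith) (by positivity) ?_ (ih (by omega)) hg hp
      rw [mul_one_div, div_mul_eq_mul_div, div_lt_one hN0]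
      exact hN
  simpa [div_self hN0.ne'] using key N le_rfl g hg hp

/-! ### The singular nonlinearity and its truncation. -/

/-- The nonlinearity `a (x⁻⁴ - x⁻³)`. -/
noncomputable def nonlinearity (a x : ℝ) : ℝ := a * (1 / x ^ 4 - 1 / x ^ 3)

/-- The nonlinearity, frozen below `δ`. -/
noncomputable def truncatedNonlinearity (a δ x : ℝ) : ℝ := nonlinearity a (max x δ)

lemma truncatedNonlinearity_of_le {a δ x : ℝ} (h : δ ≤ x) :
    truncatedNonlinearity a δ x = nonlinearity a x := by
  rw [truncatedNonlinearity, max_eq_left h]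

lemma hasDerivAt_div_pow (b : ℝ) (n : ℕ) {x : ℝ} (hx : 0 < x) :
    HasDerivAt (fun x : ℝ => b / x ^ n) (b * (-(n * x ^ (n - 1)) / (x ^ n) ^ 2)) x := by
  simpa [div_eq_mul_inv] using ((hasDerivAt_pow n x).inv (pow_ne_zero n hx.ne')).const_mul b

lemma hasDerivAt_nonlinearity (a : ℝ) {x : ℝ} (hx : 0 < x) :
    HasDerivAt (nonlinearity a) (a * (3 / x ^ 4 - 4 / x ^ 5)) x := by
  refine (((hasDerivAt_div_pow 1 4 hx).fun_sub
    (hasDerivAt_div_pow 1 3 hx)).const_mul a).congr_deriv ?_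
  field_simp
  norm_num
  ring

lemma continuousOn_nonlinearity (a : ℝ) : ContinuousOn (nonlinearity a) (Ioi 0) :=
  fun _ hx => (hasDerivAt_nonlinearity a hx).continuousAt.continuousWithinAt

/-- With s = 1/x, the polynomial 3s⁴ - 4s⁵ is maximal on s > 0 at s = 3/5, so the difference to the
maximum has the factor (s - 3/5)². -/
lemma three_div_sub_four_div_le {x : ℝ} (hx : 0 < x) :
    3 / x ^ 4 - 4 / x ^ 5 ≤ 3 ^ 5 / 5 ^ 5 := by
  have hs : 0 < 1 / x := by positivity
  have e : 3 / x ^ 4 - 4 / x ^ 5 = 3 * (1 / x) ^ 4 - 4 * (1 / x) ^ 5 := by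
    simp only [div_pow, one_pow]; ring
  rw [e]
  generalize 1 / x = s at hs
  have h : 0 ≤ (s - 3 / 5) ^ 2 * (4 * s ^ 3 + 9 / 5 * s ^ 2 + 18 / 25 * s + 27 / 125) := by
    positivity
  linarith

/-- The one-sided Lipschitz bound. -/
lemma nonlinearity_sub_le {a x y : ℝ} (ha : 0 < a) (hx : 0 < x) (hxy : x ≤ y) :
    nonlinearity a y - nonlinearity a x ≤ a * (3 ^ 5 / 5 ^ 5) * (y - x) := by
  refine (convex_Ioi (0 : ℝ)).image_sub_le_mul_sub_of_deriv_le (continuousOn_nonlinearity a)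
    ?_ ?_ x hx y (hx.trans_le hxy) hxy
  · rw [interior_Ioi]
    exact fun x hx => (hasDerivAt_nonlinearity a hx).differentiableAt.differentiableWithinAt
  · rw [interior_Ioi]
    intro x hx
    rw [(hasDerivAt_nonlinearity a hx).deriv]
    exact mul_le_mul_of_nonneg_left (three_div_sub_four_div_le hx) ha.le

lemma abs_nonlinearity_sub_le {a δ x y : ℝ} (ha : 0 < a) (hδ : 0 < δ) (hx : δ ≤ x) (hy : δ ≤ y) :
    |nonlinearity a y - nonlinearity a x| ≤ a * (3 / δ ^ 4 + 4 / δ ^ 5) * |y - x| := by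
  refine Convex.norm_image_sub_le_of_norm_deriv_le (f := nonlinearity a) (fun x hx => ?_)
    (fun x hx => ?_) (convex_Ici δ) hx hy
  · exact (hasDerivAt_nonlinearity a (hδ.trans_le hx)).differentiableAt
  · have hx0 : 0 < x := hδ.trans_le hx
    rw [(hasDerivAt_nonlinearity a hx0).deriv, norm_mul, Real.norm_of_nonneg ha.le]
    refine mul_le_mul_of_nonneg_left ((norm_sub_le _ _).trans ?_) ha.le
    rw [Real.norm_of_nonneg (by positivity), Real.norm_of_nonneg (by positivity)]
    have hx' : δ ≤ x := hx
    gcongr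

/-- The one-sided constant survives truncation, with no dependence on δ, because x ↦ max x δ is
monotone and 1-Lipschitz. -/
lemma truncatedNonlinearity_sub_mul_le {a δ : ℝ} (ha : 0 < a) (hδ : 0 < δ) (x y : ℝ) :
    (truncatedNonlinearity a δ x - truncatedNonlinearity a δ y) * (x - y)
      ≤ a * (3 ^ 5 / 5 ^ 5) * (x - y) ^ 2 := by
  have key : ∀ x y, x ≤ y → truncatedNonlinearity a δ y - truncatedNonlinearity a δ x
      ≤ a * (3 ^ 5 / 5 ^ 5) * (y - x) := fun x y hxy => by
    refine (nonlinearity_sub_le ha (hδ.trans_le (le_max_right x δ))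
      (max_le_max_right δ hxy)).trans (mul_le_mul_of_nonneg_left ?_ (by positivity))
    rcases le_total x δ with h | h
    · rw [max_eq_right h]
      rcases le_total y δ with h' | h'
      · rw [max_eq_right h']; linarith
      · rw [max_eq_left h']; linarith
    · rw [max_eq_left h, max_eq_left (h.trans hxy)]
  rcases le_total x y with h | h
  · nlinarith [mul_le_mul_of_nonneg_right (key x y h) (sub_nonneg.2 h)]
  · nlinarith [mul_le_mul_of_nonneg_right (key y x h) (sub_nonneg.2 h)]

lemma lipschitzWith_truncatedNonlinearity {a δ : ℝ} (ha : 0 < a) (hδ : 0 < δ) :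
    LipschitzWith (Real.toNNReal (a * (3 / δ ^ 4 + 4 / δ ^ 5)))
      (truncatedNonlinearity a δ) := by
  refine LipschitzWith.of_dist_le_mul fun x y => ?_
  rw [Real.coe_toNNReal _ (by positivity), Real.dist_eq, Real.dist_eq]
  refine (abs_nonlinearity_sub_le ha hδ (le_max_right _ _) (le_max_right _ _)).trans
    (mul_le_mul_of_nonneg_left ?_ (by positivity))
  exact abs_max_sub_max_le_abs x y δ

/-- With s = 1/x, s⁴ - s³ - (s - 1) = (s - 1)²(s² + s + 1). The resulting bound is convex in x,
hence suited to averaging. -/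
lemma mul_one_div_sub_one_le_nonlinearity {a x : ℝ} (ha : 0 < a) (hx : 0 < x) :
    a * (1 / x - 1) ≤ nonlinearity a x := by
  have hs : 0 < 1 / x := by positivity
  have e : 1 / x ^ 4 - 1 / x ^ 3 = (1 / x) ^ 4 - (1 / x) ^ 3 := by simp only [div_pow, one_pow]
  rw [nonlinearity, e]
  refine mul_le_mul_of_nonneg_left ?_ ha.le
  generalize 1 / x = s at hs
  have h : 0 ≤ (s - 1) ^ 2 * (s ^ 2 + s + 1) := by positivity
  linarith

lemma neg_le_nonlinearity {a x : ℝ} (ha : 0 < a) (hx : 0 < x) : -a ≤ nonlinearity a x := by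
  have h1 := mul_one_div_sub_one_le_nonlinearity ha hx
  have h2 : 0 < a * (1 / x) := by positivity
  linarith

lemma nonlinearity_eq {a x : ℝ} (hx : 0 < x) : nonlinearity a x = a * (1 - x) / x ^ 4 := by
  rw [nonlinearity]
  field_simp

lemma nonlinearity_neg {a x : ℝ} (ha : 0 < a) (hx : 1 < x) : nonlinearity a x < 0 := by
  rw [nonlinearity_eq (by linarith)]
  exact div_neg_of_neg_of_pos (mul_neg_of_pos_of_neg ha (by linarith)) (by positivity)

lemma nonlinearity_nonneg {a x : ℝ} (ha : 0 < a) (hx : 0 < x) (hx1 : x ≤ 1) :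
    0 ≤ nonlinearity a x := by
  rw [nonlinearity_eq hx]
  exact div_nonneg (mul_nonneg ha.le (by linarith)) (by positivity)

lemma strictMonoOn_nonlinearity {a : ℝ} (ha : 0 < a) :
    StrictMonoOn (nonlinearity a) (Ici (4 / 3)) := by
  refine strictMonoOn_of_deriv_pos (convex_Ici _)
    ((continuousOn_nonlinearity a).mono fun x hx => ?_) fun x hx => ?_
  · exact (show (0 : ℝ) < 4 / 3 by norm_num).trans_le hx
  · rw [interior_Ici] at hx
    have hx' : 4 / 3 < x := hx
    have hx0 : 0 < x := by linarith
    rw [(hasDerivAt_nonlinearity a hx0).deriv]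
    have : 3 / x ^ 4 - 4 / x ^ 5 = (3 * x - 4) / x ^ 5 := by field_simp
    rw [this]
    exact mul_pos ha (div_pos (by linarith) (by positivity))

lemma strictConvexOn_nonlinearity {a : ℝ} (ha : 0 < a) :
    StrictConvexOn ℝ (Ioc 0 (5 / 3)) (nonlinearity a) := by
  refine strictConvexOn_of_deriv2_pos (convex_Ioc _ _)
    ((continuousOn_nonlinearity a).mono fun x hx => hx.1) fun x hx => ?_
  rw [interior_Ioc] at hx
  have hev : deriv (nonlinearity a) =ᶠ[𝓝 x] fun x => a * (3 / x ^ 4 - 4 / x ^ 5) := by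
    filter_upwards [lt_mem_nhds hx.1] with y hy using (hasDerivAt_nonlinearity a hy).deriv
  have h2 := ((hasDerivAt_div_pow 3 4 hx.1).fun_sub (hasDerivAt_div_pow 4 5 hx.1)).const_mul a
  simp only [Function.iterate_succ, Function.iterate_zero, Function.comp, id]
  rw [hev.deriv_eq, HasDerivAt.deriv h2]
  have hx0 := hx.1
  have : 3 * (-(((4 : ℕ) : ℝ) * x ^ (4 - 1)) / (x ^ 4) ^ 2)
      - 4 * (-(((5 : ℕ) : ℝ) * x ^ (5 - 1)) / (x ^ 5) ^ 2) = (20 - 12 * x) / x ^ 6 := by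
    field_simp
    norm_num
    ring
  rw [this]
  exact mul_pos ha (div_pos (by linarith [hx.2]) (by positivity))

/-- The pointwise inequality behind the lower bound for periodic solutions. -/
lemma half_mul_le_truncatedNonlinearity_mul {a p q ξ δ x : ℝ} (ha : 0 < a) (hp : 0 < p)
    (hξ : ξ ∈ Icc p q) (hδ : 0 < δ) (hδ1 : δ ≤ 1) (hδp : δ ≤ p / 2) :
    p / 2 * (truncatedNonlinearity a δ x + a)
      ≤ truncatedNonlinearity a δ x * (ξ - x) + (16 * a / p ^ 4 + a * q) := by
  have hF : -a ≤ truncatedNonlinearity a δ x :=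
    neg_le_nonlinearity ha (hδ.trans_le (le_max_right _ _))
  have h1 : p / 2 * (truncatedNonlinearity a δ x + a)
      ≤ ξ / 2 * (truncatedNonlinearity a δ x + a) :=
    mul_le_mul_of_nonneg_right (by linarith [hξ.1]) (by linarith)
  have h2 : ξ / 2 * a ≤ a * q / 2 := by nlinarith [hξ.2]
  have h0 : 0 < 16 * a / p ^ 4 := by positivity
  have hq : 0 < a * q := mul_pos ha (hp.trans_le (hξ.1.trans hξ.2))
  -- One half of ξ has paid for the left side. In the other half, the product can be negative only
  -- for x between ξ/2 and 1, where F is at most 16a/p⁴, or between 1 and ξ/2, where F ≥ -a.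
  suffices -(16 * a / p ^ 4 + a * q / 2) ≤ truncatedNonlinearity a δ x * (ξ / 2 - x) by linarith
  rcases le_total x δ with hx | hx
  · have e : truncatedNonlinearity a δ x = nonlinearity a δ := by
      rw [truncatedNonlinearity, max_eq_right hx]
    have := nonlinearity_nonneg ha hδ hδ1
    rw [e]
    have := mul_nonneg this (show 0 ≤ ξ / 2 - x by linarith [hξ.1])
    linarith
  · rw [truncatedNonlinearity_of_le hx] at hF ⊢
    have hx0 := hδ.trans_le hx
    rcases le_or_gt x 1 with hx1 | hx1
    · have hnn := nonlinearity_nonneg ha hx0 hx1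
      rcases le_total x (ξ / 2) with hxξ | hxξ
      · have := mul_nonneg hnn (sub_nonneg.2 hxξ)
        linarith
      · have hle : nonlinearity a x ≤ 16 * a / p ^ 4 := by
          have hpx : p / 2 ≤ x := by linarith [hξ.1]
          calc nonlinearity a x ≤ a / (p / 2) ^ 4 := by
                rw [nonlinearity_eq hx0]
                have : a * (1 - x) ≤ a := by nlinarith
                gcongr
            _ = 16 * a / p ^ 4 := by field_simp; norm_num
        have : nonlinearity a x * (x - ξ / 2) ≤ 16 * a / p ^ 4 * 1 :=
          mul_le_mul hle (by linarith [hξ.1]) (by linarith) h0.le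
        linarith
    · have hneg := nonlinearity_neg ha hx1
      rcases le_total x (ξ / 2) with hxξ | hxξ
      · nlinarith [hξ.2]
      · have := mul_nonneg_of_nonpos_of_nonpos hneg.le (sub_nonpos.2 hxξ)
        linarith

/-! ### Lower bounds uniform in the truncation. -/

namespace IsPeriodicSolution

/-- A bound for the integral of the nonlinearity along a solution, uniform in the truncation. -/
lemma integral_truncatedNonlinearity_add_le {T c a p q δ μ : ℝ} {e u : ℝ → ℝ} (hT : 0 < T)
    (hc : c ≠ 0) (ha : 0 < a) (he : Continuous e) (hp : 0 < p) (hδ : 0 < δ) (hδ1 : δ ≤ 1)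
    (hδp : δ ≤ p / 2)
    (hu : IsPeriodicSolution T c (truncatedNonlinearity a δ) (fun t => μ + e t) u)
    (hav : periodAverage T u ∈ Icc p q) :
    p / 2 * ∫ t in (0 : ℝ)..T, (truncatedNonlinearity a δ (u t) + a) ≤
      T * (16 * a / p ^ 4 + a * q) + ((∫ t in (0 : ℝ)..T, e t ^ 2)
        + T * (T / 4 * ((∫ t in (0 : ℝ)..T, e t ^ 2) / c ^ 2))) / 2 := by
  have hFc : Continuous (truncatedNonlinearity a δ) :=
    (lipschitzWith_truncatedNonlinearity ha hδ).continuous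
  have c0 := hu.continuous
  have c1 := hu.continuous_deriv
  have c2 := hu.continuous_deriv_deriv
  set S := ∫ t in (0 : ℝ)..T, e t ^ 2 with hS
  set ξ := periodAverage T u with hξ
  set D := ∫ t in (0 : ℝ)..T, deriv u t ^ 2 with hD
  have hc2 : 0 < c ^ 2 := by positivity
  have hD0 : 0 ≤ D := integral_nonneg hT.le fun t _ => sq_nonneg _
  have hDS : D ≤ S / c ^ 2 := by
    rw [le_div_iff₀ hc2]
    linarith [hu.sq_mul_integral_deriv_sq_le hT hFc he]
  have hosc : ∀ t, (u t - ξ) ^ 2 ≤ T / 4 * (S / c ^ 2) := fun t => by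
    have h1 := abs_sub_periodAverage_le hT hu.hasDerivAt c1 hu.periodic hu.periodic_deriv t
    rw [← sq_abs]
    refine (pow_le_pow_left₀ (abs_nonneg _) h1 2).trans ?_
    rw [Real.sq_sqrt (by positivity)]
    exact mul_le_mul_of_nonneg_left hDS (by positivity)
  have hw : ∀ t, HasDerivAt (fun t => u t - ξ) (deriv u t) t :=
    fun t => (hu.hasDerivAt t).sub_const ξ
  have hu0 : u T = u 0 := by simpa using hu.periodic 0
  have hu1 : deriv u T = deriv u 0 := by simpa using hu.periodic_deriv 0
  have htest := integral_mul_self_eq_neg_integral_sq (α := 0) (β := T) (c := c) hw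
    hu.hasDerivAt_deriv c2 (by rw [hu0, hu1]) (by rw [hu0])
  have hint0 : ∫ t in (0 : ℝ)..T, (u t - ξ) = 0 := by
    rw [integral_sub (c0.intervalIntegrable _ _) (by simp), integral_eq_mul_periodAverage hT]
    simp [hξ]
  -- The integrand is a pointwise lower bound for (u'' + c u')(u - ξ), with e(u - ξ) handled by
  -- Young's inequality; the term in μ has mean zero.
  have hle : ∫ t in (0 : ℝ)..T, (p / 2 * (truncatedNonlinearity a δ (u t) + a)
      + μ * (u t - ξ) - (16 * a / p ^ 4 + a * q) - e t ^ 2 / 2 - (T / 4 * (S / c ^ 2)) / 2)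
      ≤ -D := by
    rw [hD, ← htest]
    refine integral_mono_on hT.le (Continuous.intervalIntegrable (by fun_prop) _ _)
      (Continuous.intervalIntegrable (by fun_prop) _ _) fun t _ => ?_
    have e1 : deriv (deriv u) t + c * deriv u t
        = μ + e t - truncatedNonlinearity a δ (u t) := by linarith [hu.equation t]
    rw [e1]
    have e2 := half_mul_le_truncatedNonlinearity_mul (x := u t) ha hp hav hδ hδ1 hδp
    nlinarith [hosc t, sq_nonneg (e t + (u t - ξ))]
  rw [integral_sub (Continuous.intervalIntegrable (by fun_prop) _ _) (by simp),
    integral_sub (Continuous.intervalIntegrable (by fun_prop) _ _)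
      (Continuous.intervalIntegrable (by fun_prop) _ _),
    integral_sub (Continuous.intervalIntegrable (by fun_prop) _ _) (by simp),
    intervalIntegral.integral_add (Continuous.intervalIntegrable (by fun_prop) _ _)
      (Continuous.intervalIntegrable (by fun_prop) _ _),
    intervalIntegral.integral_const_mul, intervalIntegral.integral_const_mul, hint0,
    intervalIntegral.integral_div, ← hS] at hle
  simp only [intervalIntegral.integral_const, sub_zero, smul_eq_mul] at hle
  linarith

/-- Solutions of the truncated problem stay above the truncation level when it is small. -/
lemma exists_forall_lt_of_truncated {T c a p : ℝ} (q : ℝ) {e : ℝ → ℝ} (hT : 0 < T)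
    (hc : c ≠ 0) (ha : 0 < a) (he : Continuous e) (hp : 0 < p) :
    ∃ δ₀ > 0, ∀ δ, 0 < δ → δ ≤ δ₀ → ∀ μ u,
      IsPeriodicSolution T c (truncatedNonlinearity a δ) (fun t => μ + e t) u →
      periodAverage T u ∈ Icc p q → ∀ t, δ < u t := by
  set S := ∫ t in (0 : ℝ)..T, e t ^ 2 with hS
  set B := T * (16 * a / p ^ 4 + a * q) + (S + T * (T / 4 * (S / c ^ 2))) / 2 with hB
  set E := √(S / c ^ 2) with hE
  have hE0 : 0 ≤ E := Real.sqrt_nonneg _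
  have hev : ∀ᶠ δ in 𝓝 (0 : ℝ), δ < 1 ∧ δ < p / 2 ∧ (1 + E) * δ < 1 / 2 ∧ δ ^ 2 < T ∧
      4 * B * (1 + E) ^ 4 * δ ^ 2 < a * p := by
    have aux : ∀ (F : ℝ → ℝ) (b : ℝ), Continuous F → F 0 < b → ∀ᶠ δ in 𝓝 (0 : ℝ), F δ < b :=
      fun F b hF h => hF.continuousAt.eventually_lt_const h
    refine (aux _ _ continuous_id (by simp)).and ((aux _ _ continuous_id ?_).and
      ((aux _ _ (by fun_prop) ?_).and ((aux _ _ (by fun_prop) ?_).and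
        (aux _ _ (by fun_prop) ?_))))
    · simpa using hp
    · simp
    · simpa using hT
    · simpa using mul_pos ha hp
  obtain ⟨r, hr, hball⟩ := Metric.eventually_nhds_iff.1 hev
  refine ⟨r / 2, by positivity, fun δ hδ hδr μ u hu hav t₀ => ?_⟩
  obtain ⟨hδ1, hδp, hδE, hδT, hδB⟩ := hball (y := δ) (by
    rw [Real.dist_eq, sub_zero, abs_of_pos hδ]; linarith)
  by_contra! hle
  have hFc : Continuous (truncatedNonlinearity a δ) :=
    (lipschitzWith_truncatedNonlinearity ha hδ).continuous
  have c0 := hu.continuous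
  have c1 := hu.continuous_deriv
  have hc2 : 0 < c ^ 2 := by positivity
  have hS0 : 0 ≤ S := integral_nonneg hT.le fun t _ => sq_nonneg _
  have hE2 : E ^ 2 = S / c ^ 2 := Real.sq_sqrt (by positivity)
  have hF : ∀ x, 0 ≤ truncatedNonlinearity a δ x + a := fun x => by
    have : -a ≤ truncatedNonlinearity a δ x :=
      neg_le_nonlinearity ha (hδ.trans_le (le_max_right _ _))
    linarith
  have hI := hu.integral_truncatedNonlinearity_add_le hT hc ha he hp hδ hδ1.le hδp.le hav
  rw [← hS, ← hB] at hI
  have hper : Function.Periodic (fun t => truncatedNonlinearity a δ (u t) + a) T :=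
    fun t => by simp [hu.periodic t]
  have hshift := hper.intervalIntegral_add_eq t₀ 0
  have hDper : Function.Periodic (fun t => deriv u t ^ 2) T :=
    fun t => by simp [hu.periodic_deriv t]
  have hDshift := hDper.intervalIntegral_add_eq t₀ 0
  rw [zero_add] at hshift hDshift
  have hD : ∫ t in t₀..(t₀ + T), deriv u t ^ 2 ≤ E ^ 2 := by
    rw [hDshift, hE2, le_div_iff₀ hc2]
    linarith [hu.sq_mul_integral_deriv_sq_le hT hFc he]
  -- If u(t₀) ≤ δ, the bound on u' keeps u below (1 + E)δ for a time δ². There F + a is at least of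
  -- order δ⁻⁴, so its integral is of order δ⁻², which exceeds the uniform bound for small δ.
  have hlow : ∀ t ∈ Icc t₀ (t₀ + δ ^ 2),
      a / (2 * ((1 + E) * δ) ^ 4) ≤ truncatedNonlinearity a δ (u t) + a := by
    intro t ht
    have h1 := sq_sub_le_mul_integral_deriv_sq ht.1 hu.hasDerivAt c1
    have h2 : ∫ t in t₀..t, deriv u t ^ 2 ≤ ∫ t in t₀..(t₀ + T), deriv u t ^ 2 :=
      integral_mono_interval le_rfl ht.1 (by linarith [ht.2])
        (Eventually.of_forall fun t => sq_nonneg _)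
        (Continuous.intervalIntegrable (by fun_prop) _ _)
    have h3 : (u t - u t₀) ^ 2 ≤ (δ * E) ^ 2 := by
      rw [mul_pow]
      exact h1.trans (mul_le_mul (by linarith [ht.2]) (h2.trans hD)
        (integral_nonneg ht.1 fun t _ => sq_nonneg _) (by positivity))
    have h4 := (abs_le_of_sq_le_sq' h3 (by positivity)).2
    have hx : max (u t) δ ≤ (1 + E) * δ := max_le (by linarith) (by nlinarith)
    have hx0 : 0 < max (u t) δ := hδ.trans_le (le_max_right _ _)
    rw [truncatedNonlinearity, nonlinearity_eq hx0]
    generalize max (u t) δ = x at hx hx0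
    calc a / (2 * ((1 + E) * δ) ^ 4) ≤ a / (2 * x ^ 4) := by gcongr
      _ = a * (1 / 2) / x ^ 4 := by field_simp
      _ ≤ a * (1 - x) / x ^ 4 := by gcongr; linarith
      _ ≤ _ := by linarith
  have h5 : ∫ t in t₀..(t₀ + δ ^ 2), a / (2 * ((1 + E) * δ) ^ 4)
      ≤ ∫ t in t₀..(t₀ + δ ^ 2), (truncatedNonlinearity a δ (u t) + a) :=
    integral_mono_on (by nlinarith) (by simp) (Continuous.intervalIntegrable (by fun_prop) _ _)
      hlow
  have h6 : ∫ t in t₀..(t₀ + δ ^ 2), (truncatedNonlinearity a δ (u t) + a)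
      ≤ ∫ t in t₀..(t₀ + T), (truncatedNonlinearity a δ (u t) + a) :=
    integral_mono_interval le_rfl (by nlinarith) (by linarith)
      (Eventually.of_forall fun t => hF _) (Continuous.intervalIntegrable (by fun_prop) _ _)
  rw [intervalIntegral.integral_const, smul_eq_mul, add_sub_cancel_left] at h5
  rw [hshift] at h6
  have h7 : p / 2 * (δ ^ 2 * (a / (2 * ((1 + E) * δ) ^ 4))) ≤ B :=
    (mul_le_mul_of_nonneg_left (h5.trans h6) (by positivity)).trans hI
  have h8 : p / 2 * (δ ^ 2 * (a / (2 * ((1 + E) * δ) ^ 4)))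
      = a * p / (4 * (1 + E) ^ 4 * δ ^ 2) := by
    field_simp
    norm_num
  rw [h8, div_le_iff₀ (by positivity)] at h7
  linarith

end IsPeriodicSolution

/-! ### Existence and continuity for the singular equation. -/

namespace IsPositivePeriodicSolution

variable {T c a μ : ℝ} {e u : ℝ → ℝ}

lemma isPeriodicSolution_truncated {δ : ℝ} (hu : IsPositivePeriodicSolution T c a e μ u)
    (hδ : ∀ t, δ ≤ u t) :
    IsPeriodicSolution T c (truncatedNonlinearity a δ) (fun t => μ + e t) u :=
  ⟨hu.contDiff, hu.periodic, fun t => by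
    rw [truncatedNonlinearity_of_le (hδ t)]; exact hu.equation t⟩

lemma isPeriodicSolution (hu : IsPositivePeriodicSolution T c a e μ u) :
    IsPeriodicSolution T c (nonlinearity a) (fun t => μ + e t) u :=
  ⟨hu.contDiff, hu.periodic, hu.equation⟩

end IsPositivePeriodicSolution

lemma IsPeriodicSolution.isPositivePeriodicSolution {T c a δ μ : ℝ} {e u : ℝ → ℝ}
    (hu : IsPeriodicSolution T c (truncatedNonlinearity a δ) (fun t => μ + e t) u) (hδ : 0 < δ)
    (hle : ∀ t, δ ≤ u t) : IsPositivePeriodicSolution T c a e μ u :=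
  ⟨hu.contDiff, hu.periodic, fun t => hδ.trans_le (hle t), fun t => by
    have := hu.equation t
    rwa [truncatedNonlinearity_of_le (hle t)] at this⟩

lemma exists_forall_le_of_continuous_periodic {T : ℝ} (hT : 0 < T) {u : ℝ → ℝ}
    (hu : Continuous u) (hp : Function.Periodic u T) : ∃ t₀, ∀ t, u t₀ ≤ u t := by
  obtain ⟨t₀, -, ht₀⟩ := isCompact_Icc.exists_isMinOn (nonempty_Icc.2 hT.le) hu.continuousOn
  refine ⟨t₀, fun t => ?_⟩
  obtain ⟨s, hs, hs'⟩ := hp.exists_mem_Ico₀ hT t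
  rw [hs']
  exact ht₀ (Ico_subset_Icc_self hs)

/-- A positive lower bound for all positive periodic solutions with average in a compact
interval. -/
lemma exists_forall_lt_of_isPositivePeriodicSolution {T c a p : ℝ} (q : ℝ) {e : ℝ → ℝ}
    (hT : 0 < T) (hc : c ≠ 0) (ha : 0 < a) (he : Continuous e) (hp : 0 < p) :
    ∃ δ > 0, ∀ μ u, IsPositivePeriodicSolution T c a e μ u →
      periodAverage T u ∈ Icc p q → ∀ t, δ < u t := by
  obtain ⟨δ₀, hδ₀, H⟩ := IsPeriodicSolution.exists_forall_lt_of_truncated q hT hc ha he hp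
  refine ⟨δ₀, hδ₀, fun μ u hu hav t => ?_⟩
  obtain ⟨t₀, ht₀⟩ :=
    exists_forall_le_of_continuous_periodic hT hu.contDiff.continuous hu.periodic
  -- Truncation at the minimum of u itself leaves the equation unchanged; were this level at most
  -- δ₀, u would lie strictly above its own minimum.
  by_contra! hle
  exact lt_irrefl _ (H (u t₀) (hu.pos t₀) ((ht₀ t).trans hle) μ u
    (hu.isPeriodicSolution_truncated ht₀) hav t₀)

lemma exists_isPositivePeriodicSolution {T c a k : ℝ} (hT : 0 < T) (hc : c ≠ 0) (ha : 0 < a)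
    (hk : 0 ≤ k) (hkT : k * T < 2 * Real.pi) (hak : a * (3 ^ 5 / 5 ^ 5) < k ^ 2) {e : ℝ → ℝ}
    (he : Continuous e) (heT : Function.Periodic e T) {ξ : ℝ} (hξ : 0 < ξ) :
    ∃ μ u, IsPositivePeriodicSolution T c a e μ u ∧ periodAverage T u = ξ := by
  obtain ⟨δ, hδ, H⟩ := IsPeriodicSolution.exists_forall_lt_of_truncated ξ hT hc ha he hξ
  obtain ⟨μ, u, hu, hav⟩ := exists_isPeriodicSolution hT hc hk hkT (by positivity) hak
    (lipschitzWith_truncatedNonlinearity ha hδ) (truncatedNonlinearity_sub_mul_le ha hδ) ξ he heT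
  exact ⟨μ, u, hu.isPositivePeriodicSolution hδ fun t =>
    (H δ hδ le_rfl μ u hu (by simp [hav]) t).le, hav⟩

/-- The derivative terms and e have mean zero, so μ is the average of F(u); every estimate on φ
rests on this. -/
lemma IsPositivePeriodicSolution.integral_nonlinearity {T c a μ : ℝ} {e u : ℝ → ℝ}
    (he : Continuous e) (he0 : ∫ t in (0 : ℝ)..T, e t = 0)
    (hu : IsPositivePeriodicSolution T c a e μ u) :
    ∫ t in (0 : ℝ)..T, nonlinearity a (u t) = T * μ := by
  have hu' := hu.isPeriodicSolution
  have c1 := hu'.continuous_deriv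
  have c2 := hu'.continuous_deriv_deriv
  have hu0 : u T = u 0 := by simpa using hu.periodic 0
  have hu1 : deriv u T = deriv u 0 := by simpa using hu'.periodic_deriv 0
  have e1 : ∀ t, nonlinearity a (u t) = μ + e t - deriv (deriv u) t - c * deriv u t :=
    fun t => by linarith [hu'.equation t]
  simp only [e1]
  rw [integral_sub (Continuous.intervalIntegrable (by fun_prop) _ _)
      (Continuous.intervalIntegrable (by fun_prop) _ _),
    integral_sub (Continuous.intervalIntegrable (by fun_prop) _ _)
      (Continuous.intervalIntegrable (by fun_prop) _ _),
    intervalIntegral.integral_add (by simp) (he.intervalIntegrable _ _),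
    intervalIntegral.integral_const_mul, he0,
    integral_eq_sub_of_hasDerivAt (fun t _ => hu'.hasDerivAt t) (c1.intervalIntegrable _ _),
    integral_eq_sub_of_hasDerivAt (fun t _ => hu'.hasDerivAt_deriv t)
      (c2.intervalIntegrable _ _), hu0, hu1]
  simp

lemma IsPositivePeriodicSolution.continuous_nonlinearity {T c a μ : ℝ} {e u : ℝ → ℝ}
    (hu : IsPositivePeriodicSolution T c a e μ u) : Continuous fun t => nonlinearity a (u t) :=
  (continuousOn_nonlinearity a).comp_continuous hu.contDiff.continuous hu.pos

/-- Positive periodic solutions depend locally Lipschitz continuously on their average. -/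
lemma exists_forall_abs_sub_le {T c a k p : ℝ} (q : ℝ) (hT : 0 < T) (hc : c ≠ 0) (ha : 0 < a)
    (hk : 0 ≤ k) (hkT : k * T < 2 * Real.pi) (hak : a * (3 ^ 5 / 5 ^ 5) < k ^ 2) {e : ℝ → ℝ}
    (he : Continuous e) (he0 : ∫ t in (0 : ℝ)..T, e t = 0) (hp : 0 < p) :
    ∃ M, 0 ≤ M ∧ ∀ μ₁ u₁ μ₂ u₂, IsPositivePeriodicSolution T c a e μ₁ u₁ →
      IsPositivePeriodicSolution T c a e μ₂ u₂ → periodAverage T u₁ ∈ Icc p q →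
      periodAverage T u₂ ∈ Icc p q →
      (∀ t, |u₁ t - u₂ t| ≤ M * |periodAverage T u₁ - periodAverage T u₂|) ∧
      |μ₁ - μ₂| ≤ M * |periodAverage T u₁ - periodAverage T u₂| := by
  obtain ⟨δ, hδ, H⟩ := exists_forall_lt_of_isPositivePeriodicSolution q hT hc ha he hp
  set L := a * (3 / δ ^ 4 + 4 / δ ^ 5) with hL
  have hL0 : 0 ≤ L := by positivity
  have hq : 0 < 1 - a * (3 ^ 5 / 5 ^ 5) / k ^ 2 := by
    rw [sub_pos, div_lt_one ((by positivity : (0 : ℝ) < a * (3 ^ 5 / 5 ^ 5)).trans hak)]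
    exact hak
  set C := T ^ 2 / (4 * (1 - a * (3 ^ 5 / 5 ^ 5) / k ^ 2)) with hC
  have hC0 : 0 ≤ C := by positivity
  refine ⟨max (C * L + 1) (L * (C * L + 1)), le_max_of_le_left (by positivity),
    fun μ₁ u₁ μ₂ u₂ h₁ h₂ hav₁ hav₂ => ?_⟩
  have l₁ := H μ₁ u₁ h₁ hav₁
  have l₂ := H μ₂ u₂ h₂ hav₂
  have s₁ := h₁.isPeriodicSolution_truncated fun t => (l₁ t).le
  have s₂ := h₂.isPeriodicSolution_truncated fun t => (l₂ t).le
  have hlip := lipschitzWith_truncatedNonlinearity ha hδ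
  set d := periodAverage T u₁ - periodAverage T u₂ with hd
  -- Shifting u₂ by d equalizes the averages, at the cost of a change of forcing of size at most
  -- L|d|.
  have s₂' : IsPeriodicSolution T c (truncatedNonlinearity a δ) (fun t => μ₂ + (e t +
      (truncatedNonlinearity a δ (u₂ t + d) - truncatedNonlinearity a δ (u₂ t))))
      (fun t => u₂ t + d) := by
    refine ⟨s₂.contDiff.add contDiff_const, fun t => by simp [s₂.periodic t], fun t => ?_⟩
    have hd1 : deriv (fun t => u₂ t + d) = deriv u₂ := funext fun t => deriv_add_const d
    rw [hd1]
    linarith [s₂.equation t]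
  have hmain : ∀ t, |u₁ t - u₂ t| ≤ (C * L + 1) * |d| := by
    intro t
    have := IsPeriodicSolution.abs_sub_le_of_abs_sub_le (ε := L * |d|) hT hk hkT (by positivity)
      hak (truncatedNonlinearity_sub_mul_le ha hδ) (fun t => ?_) s₁ s₂'
      (by rw [periodAverage_add_const hT s₂.continuous]; simp [d]) t
    · rw [← hC] at this
      have h1 : |u₁ t - u₂ t| ≤ |u₁ t - (u₂ t + d)| + |d| := by
        have : u₁ t - u₂ t = (u₁ t - (u₂ t + d)) + d := by ring
        rw [this]
        exact abs_add_le _ _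
      linarith
    · have := hlip.dist_le_mul (u₂ t + d) (u₂ t)
      rw [Real.coe_toNNReal _ hL0, Real.dist_eq, Real.dist_eq, add_sub_cancel_left] at this
      have e1 : e t - (e t + (truncatedNonlinearity a δ (u₂ t + d)
        - truncatedNonlinearity a δ (u₂ t))) = -(truncatedNonlinearity a δ (u₂ t + d)
        - truncatedNonlinearity a δ (u₂ t)) := by ring
      rw [e1, abs_neg]
      exact this
  refine ⟨fun t => (hmain t).trans (mul_le_mul_of_nonneg_right (le_max_left _ _) (abs_nonneg _)),
    ?_⟩
  refine le_trans ?_ (mul_le_mul_of_nonneg_right (le_max_right _ _) (abs_nonneg _))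
  have hpt : ∀ t, |nonlinearity a (u₁ t) - nonlinearity a (u₂ t)| ≤ L * (C * L + 1) * |d| :=
    fun t => (abs_nonlinearity_sub_le ha hδ (l₂ t).le (l₁ t).le).trans (by
      rw [mul_assoc L]; exact mul_le_mul_of_nonneg_left (hmain t) hL0)
  have hint := norm_integral_le_of_norm_le_const (a := 0) (b := T)
    (f := fun t => nonlinearity a (u₁ t) - nonlinearity a (u₂ t)) fun t _ => hpt t
  rw [integral_sub (h₁.continuous_nonlinearity.intervalIntegrable _ _)
    (h₂.continuous_nonlinearity.intervalIntegrable _ _), h₁.integral_nonlinearity he he0,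
    h₂.integral_nonlinearity he he0, ← mul_sub, Real.norm_eq_abs, abs_mul, sub_zero,
    abs_of_pos hT, mul_comm _ T] at hint
  exact le_of_mul_le_mul_left hint hT

/-! ### Exclusion of three solutions and estimates on the parameter. -/

/-- A negative second derivative would make the point also a local maximum, so the function would be
locally constant. -/
lemma deriv_deriv_nonneg_of_isLocalMin {h : ℝ → ℝ} {t₀ : ℝ} (hc : ContinuousAt h t₀)
    (hmin : IsLocalMin h t₀) : 0 ≤ deriv (deriv h) t₀ := by
  by_contra! hneg
  have hmax := isLocalMax_of_deriv_deriv_neg hneg hmin.deriv_eq_zero hc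
  have hev : h =ᶠ[𝓝 t₀] fun _ => h t₀ := by
    filter_upwards [hmin, hmax] with t h1 h2 using le_antisymm h2 h1
  have : deriv (deriv h) t₀ = 0 := by
    rw [hev.deriv.deriv_eq]
    simp
  linarith

/-- There are no three ordered solutions in the region of strict convexity. -/
lemma not_exists_three_of_le {T c a μ : ℝ} (hT : 0 < T) (ha : 0 < a) {e u₁ u₂ u₃ : ℝ → ℝ}
    (h₁ : IsPositivePeriodicSolution T c a e μ u₁) (h₂ : IsPositivePeriodicSolution T c a e μ u₂)
    (h₃ : IsPositivePeriodicSolution T c a e μ u₃) (h₁₂ : ∀ t, u₁ t < u₂ t)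
    (h₂₃ : ∀ t, u₂ t < u₃ t) (hle : ∀ t, u₃ t ≤ 5 / 3) : False := by
  have s₁ := h₁.isPeriodicSolution
  have s₂ := h₂.isPeriodicSolution
  have s₃ := h₃.isPeriodicSolution
  have c₁ := s₁.continuous
  have c₂ := s₂.continuous
  have c₃ := s₃.continuous
  -- With k the minimum of this quotient, z = u₃ - u₂ - k(u₂ - u₁) is nonnegative and vanishes at
  -- t₀, so z' = 0 and z'' ≥ 0 there. The equation expresses z'' through increments of F, and strict
  -- convexity makes it negative.
  obtain ⟨t₀, ht₀⟩ := exists_forall_le_of_continuous_periodic hT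
    (u := fun t => (u₃ t - u₂ t) / (u₂ t - u₁ t))
    (Continuous.div (by fun_prop) (by fun_prop) fun t => (sub_pos.2 (h₁₂ t)).ne')
    (fun t => by simp [s₁.periodic t, s₂.periodic t, s₃.periodic t])
  set k := (u₃ t₀ - u₂ t₀) / (u₂ t₀ - u₁ t₀) with hk
  have hk0 : 0 < k := div_pos (sub_pos.2 (h₂₃ t₀)) (sub_pos.2 (h₁₂ t₀))
  have hkt : u₃ t₀ - u₂ t₀ = k * (u₂ t₀ - u₁ t₀) := by
    rw [hk, div_mul_cancel₀ _ (sub_pos.2 (h₁₂ t₀)).ne']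
  have hd : ∀ t, HasDerivAt (fun t => u₃ t - u₂ t - k * (u₂ t - u₁ t))
      (deriv u₃ t - deriv u₂ t - k * (deriv u₂ t - deriv u₁ t)) t := fun t =>
    ((s₃.hasDerivAt t).sub (s₂.hasDerivAt t)).sub
      (((s₂.hasDerivAt t).sub (s₁.hasDerivAt t)).const_mul k)
  have hd' : HasDerivAt (fun t => deriv u₃ t - deriv u₂ t - k * (deriv u₂ t - deriv u₁ t))
      (deriv (deriv u₃) t₀ - deriv (deriv u₂) t₀
        - k * (deriv (deriv u₂) t₀ - deriv (deriv u₁) t₀)) t₀ :=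
    ((s₃.hasDerivAt_deriv t₀).sub (s₂.hasDerivAt_deriv t₀)).sub
      (((s₂.hasDerivAt_deriv t₀).sub (s₁.hasDerivAt_deriv t₀)).const_mul k)
  have hmin : IsLocalMin (fun t => u₃ t - u₂ t - k * (u₂ t - u₁ t)) t₀ :=
    Eventually.of_forall fun t => by
      have := (le_div_iff₀ (sub_pos.2 (h₁₂ t))).1 (ht₀ t)
      simp only [hkt]
      linarith
  have hone := hmin.hasDerivAt_eq_zero (hd t₀)
  have htwo := deriv_deriv_nonneg_of_isLocalMin (hd t₀).continuousAt hmin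
  rw [funext fun t => (hd t).deriv, hd'.deriv] at htwo
  have hconv := (strictConvexOn_nonlinearity ha).slope_strict_mono_adjacent
    (show u₁ t₀ ∈ Ioc 0 (5 / 3) from
      ⟨h₁.pos t₀, ((h₁₂ t₀).trans (h₂₃ t₀)).le.trans (hle t₀)⟩)
    (show u₃ t₀ ∈ Ioc 0 (5 / 3) from ⟨h₃.pos t₀, hle t₀⟩) (h₁₂ t₀) (h₂₃ t₀)
  have hpos₁ := sub_pos.2 (h₁₂ t₀)
  rw [hkt, div_lt_div_iff₀ hpos₁ (mul_pos hk0 hpos₁), ← mul_assoc] at hconv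
  have hconv' := lt_of_mul_lt_mul_right hconv hpos₁.le
  have e₁ := s₁.equation t₀
  have e₂ := s₂.equation t₀
  have e₃ := s₃.equation t₀
  have hid : deriv (deriv u₃) t₀ - deriv (deriv u₂) t₀
      - k * (deriv (deriv u₂) t₀ - deriv (deriv u₁) t₀)
      = -(nonlinearity a (u₃ t₀) - nonlinearity a (u₂ t₀))
        + k * (nonlinearity a (u₂ t₀) - nonlinearity a (u₁ t₀)) := by
    linear_combination e₃ - e₂ - k * (e₂ - e₁) - c * hone
  linarith

namespace IsPositivePeriodicSolution

variable {T c a μ : ℝ} {e u : ℝ → ℝ}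

lemma mul_integral_deriv_sq_le (hT : 0 < T) (hc : c ≠ 0) (ha : 0 < a) (he : Continuous e)
    (hS : 3 * T * ∫ t in (0 : ℝ)..T, e t ^ 2 < c ^ 2)
    (hu : IsPositivePeriodicSolution T c a e μ u) :
    T / 4 * ∫ t in (0 : ℝ)..T, deriv u t ^ 2 ≤ 1 / 12 := by
  obtain ⟨t₀, ht₀⟩ :=
    exists_forall_le_of_continuous_periodic hT hu.contDiff.continuous hu.periodic
  have h := (hu.isPeriodicSolution_truncated ht₀).sq_mul_integral_deriv_sq_le hT
    (lipschitzWith_truncatedNonlinearity ha (hu.pos t₀)).continuous he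
  set D := ∫ t in (0 : ℝ)..T, deriv u t ^ 2
  have hc2 : 0 < c ^ 2 := by positivity
  have h1 : c ^ 2 * (3 * T * D) ≤ c ^ 2 * 1 := by
    have := mul_le_mul_of_nonneg_left h (show 0 ≤ 3 * T by positivity)
    linarith
  have := le_of_mul_le_mul_left h1 hc2
  linarith

lemma sq_sub_le (hT : 0 < T) (hc : c ≠ 0) (ha : 0 < a) (he : Continuous e)
    (hS : 3 * T * ∫ t in (0 : ℝ)..T, e t ^ 2 < c ^ 2)
    (hu : IsPositivePeriodicSolution T c a e μ u) (s t : ℝ) : (u s - u t) ^ 2 ≤ 1 / 12 := by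
  have hu' := hu.isPeriodicSolution
  exact (sq_sub_le_of_periodic hT hu'.hasDerivAt hu'.continuous_deriv hu'.periodic
    hu'.periodic_deriv s t).trans (hu.mul_integral_deriv_sq_le hT hc ha he hS)

lemma abs_sub_periodAverage_le_one (hT : 0 < T) (hc : c ≠ 0) (ha : 0 < a) (he : Continuous e)
    (hS : 3 * T * ∫ t in (0 : ℝ)..T, e t ^ 2 < c ^ 2)
    (hu : IsPositivePeriodicSolution T c a e μ u) (t : ℝ) : |u t - periodAverage T u| ≤ 1 := by
  have hu' := hu.isPeriodicSolution
  refine (abs_sub_periodAverage_le hT hu'.hasDerivAt hu'.continuous_deriv hu'.periodic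
    hu'.periodic_deriv t).trans (Real.sqrt_le_one.2 ?_)
  have := hu.mul_integral_deriv_sq_le hT hc ha he hS
  linarith

lemma periodAverage_pos (hT : 0 < T) (hu : IsPositivePeriodicSolution T c a e μ u) :
    0 < periodAverage T u :=
  mul_pos (by positivity) (intervalIntegral_pos_of_pos
    (hu.contDiff.continuous.intervalIntegrable _ _) hu.pos hT)

lemma lt_of_periodAverage_lt {k : ℝ} (hT : 0 < T) (ha : 0 < a) (hk : 0 ≤ k)
    (hkT : k * T < 2 * Real.pi) (hak : a * (3 ^ 5 / 5 ^ 5) < k ^ 2) {v : ℝ → ℝ}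
    (hu : IsPositivePeriodicSolution T c a e μ u) (hv : IsPositivePeriodicSolution T c a e μ v)
    (hav : periodAverage T u < periodAverage T v) (t : ℝ) : u t < v t := by
  obtain ⟨t₁, ht₁⟩ :=
    exists_forall_le_of_continuous_periodic hT hu.contDiff.continuous hu.periodic
  obtain ⟨t₂, ht₂⟩ :=
    exists_forall_le_of_continuous_periodic hT hv.contDiff.continuous hv.periodic
  have hδ : 0 < min (u t₁) (v t₂) := lt_min (hu.pos _) (hv.pos _)
  exact IsPeriodicSolution.lt_of_periodAverage_lt hT hk hkT hak
    (lipschitzWith_truncatedNonlinearity ha hδ) (truncatedNonlinearity_sub_mul_le ha hδ)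
    (hu.isPeriodicSolution_truncated fun t => (min_le_left _ _).trans (ht₁ t))
    (hv.isPeriodicSolution_truncated fun t => (min_le_right _ _).trans (ht₂ t)) hav t

/-- The parameter is bounded below by any lower bound of the nonlinearity along the solution. -/
lemma le_of_forall_le (hT : 0 < T) (he : Continuous e) (he0 : ∫ t in (0 : ℝ)..T, e t = 0)
    (hu : IsPositivePeriodicSolution T c a e μ u) {b : ℝ}
    (hb : ∀ t, b ≤ nonlinearity a (u t)) : b ≤ μ := by
  have := integral_mono_on (μ := volume) hT.le (by simp)
    (hu.continuous_nonlinearity.intervalIntegrable 0 T) fun t _ => hb t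
  rw [hu.integral_nonlinearity he he0] at this
  simp only [intervalIntegral.integral_const, sub_zero, smul_eq_mul] at this
  exact le_of_mul_le_mul_left this hT

lemma neg_of_forall_one_lt (hT : 0 < T) (ha : 0 < a) (he : Continuous e)
    (he0 : ∫ t in (0 : ℝ)..T, e t = 0) (hu : IsPositivePeriodicSolution T c a e μ u)
    (h1 : ∀ t, 1 < u t) : μ < 0 := by
  have := intervalIntegral_pos_of_pos (f := fun t => -nonlinearity a (u t))
    (hu.continuous_nonlinearity.neg.intervalIntegrable 0 T)
    (fun t => neg_pos.2 (nonlinearity_neg ha (h1 t))) hT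
  rw [intervalIntegral.integral_neg, hu.integral_nonlinearity he he0] at this
  nlinarith

/-- Jensen's inequality for 1/x, by averaging its tangent line at ξ; it forces blow-up as ξ → 0. -/
lemma mul_inv_periodAverage_sub_one_le (hT : 0 < T) (ha : 0 < a) (he : Continuous e)
    (he0 : ∫ t in (0 : ℝ)..T, e t = 0) (hu : IsPositivePeriodicSolution T c a e μ u) :
    a * ((periodAverage T u)⁻¹ - 1) ≤ μ := by
  have c0 := hu.contDiff.continuous
  have hξ := hu.periodAverage_pos hT
  have hI := integral_eq_mul_periodAverage hT u
  set ξ := periodAverage T u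
  have hpt : ∀ t, a * (2 / ξ - 1) - a / ξ ^ 2 * u t ≤ nonlinearity a (u t) := fun t => by
    have h1 := mul_one_div_sub_one_le_nonlinearity ha (hu.pos t)
    have h2 : 2 / ξ - u t / ξ ^ 2 ≤ 1 / u t := by
      have hut := hu.pos t
      rw [← sub_nonneg]
      have : 1 / u t - (2 / ξ - u t / ξ ^ 2) = (u t - ξ) ^ 2 / (u t * ξ ^ 2) := by
        field_simp
        ring
      rw [this]
      positivity
    have h3 := mul_le_mul_of_nonneg_left h2 ha.le
    have h4 : a * (u t / ξ ^ 2) = a / ξ ^ 2 * u t := by ring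
    linarith
  have := integral_mono_on (μ := volume) hT.le (Continuous.intervalIntegrable (by fun_prop) _ _)
    (hu.continuous_nonlinearity.intervalIntegrable 0 T) fun t _ => hpt t
  rw [hu.integral_nonlinearity he he0, integral_sub (by simp)
    (Continuous.intervalIntegrable (by fun_prop) _ _), intervalIntegral.integral_const_mul _ u, hI]
    at this
  simp only [intervalIntegral.integral_const, sub_zero, smul_eq_mul] at this
  refine le_of_mul_le_mul_left (le_trans (le_of_eq ?_) this) hT
  field_simp
  ring

end IsPositivePeriodicSolution

/-- Three solutions for the same parameter cannot have two of them close to each other. -/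
lemma not_exists_three {T c a k μ : ℝ} (hT : 0 < T) (hc : c ≠ 0) (ha : 0 < a) (hk : 0 ≤ k)
    (hkT : k * T < 2 * Real.pi) (hak : a * (3 ^ 5 / 5 ^ 5) < k ^ 2) {e u₁ u₂ u₃ : ℝ → ℝ}
    (he : Continuous e) (he0 : ∫ t in (0 : ℝ)..T, e t = 0)
    (hS : 3 * T * ∫ t in (0 : ℝ)..T, e t ^ 2 < c ^ 2)
    (h₁ : IsPositivePeriodicSolution T c a e μ u₁) (h₂ : IsPositivePeriodicSolution T c a e μ u₂)
    (h₃ : IsPositivePeriodicSolution T c a e μ u₃)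
    (h₁₂ : periodAverage T u₁ < periodAverage T u₂)
    (h₂₃ : periodAverage T u₂ < periodAverage T u₃) (hle : ∀ t, |u₃ t - u₂ t| ≤ 1 / 25) :
    False := by
  have l₁₂ := h₁.lt_of_periodAverage_lt hT ha hk hkT hak h₂ h₁₂
  have l₂₃ := h₂.lt_of_periodAverage_lt hT ha hk hkT hak h₃ h₂₃
  obtain ⟨t₀, ht₀⟩ : ∃ t, nonlinearity a (u₃ t) ≤ nonlinearity a (u₂ t) := by
    by_contra! hlt
    have := intervalIntegral_pos_of_pos
      (f := fun t => nonlinearity a (u₃ t) - nonlinearity a (u₂ t))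
      ((h₃.continuous_nonlinearity.sub h₂.continuous_nonlinearity).intervalIntegrable 0 T)
      (fun t => sub_pos.2 (hlt t)) hT
    rw [integral_sub (h₃.continuous_nonlinearity.intervalIntegrable _ _)
      (h₂.continuous_nonlinearity.intervalIntegrable _ _), h₃.integral_nonlinearity he he0,
      h₂.integral_nonlinearity he he0, sub_self] at this
    exact lt_irrefl _ this
  have h43 : u₂ t₀ < 4 / 3 := by
    by_contra! hge
    exact absurd ht₀ (not_le.2 (strictMonoOn_nonlinearity ha hge (hge.trans (l₂₃ t₀).le) (l₂₃ t₀)))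
  refine not_exists_three_of_le hT ha h₁ h₂ h₃ l₁₂ l₂₃ fun t => ?_
  -- Here 22/75 slightly exceeds 1/√12, and 4/3 + 22/75 + 1/25 = 5/3 places all three solutions in
  -- the convexity region.
  have hosc := h₂.sq_sub_le hT hc ha he hS t t₀
  have h4 := (abs_le_of_sq_le_sq' (hosc.trans (show (1 : ℝ) / 12 ≤ (22 / 75) ^ 2 by norm_num))
    (by norm_num)).2
  linarith [(abs_le.1 (hle t)).2]

/-! ### Strict quasiconvexity and minima of real functions. -/

/-- A continuous function that blows up at zero and takes no value at three points of which the
last two are close is strictly quasiconvex. -/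
lemma lt_max_of_locally_not_three {φ : ℝ → ℝ} (hφ : ContinuousOn φ (Ioi 0))
    (h0 : Tendsto φ (𝓝[>] 0) atTop)
    (h3 : ∀ y > 0, ∃ η > 0, ∀ x₁ x₂ x₃, 0 < x₁ → x₁ < x₂ → x₂ < x₃ → |x₂ - y| < η →
      |x₃ - y| < η → φ x₁ = φ x₂ → φ x₂ = φ x₃ → False)
    {x y z : ℝ} (hx : 0 < x) (hxy : x < y) (hyz : y < z) : φ y < max (φ x) (φ z) := by
  by_contra! hmax
  obtain ⟨m, hm, hmle⟩ : ∃ m ∈ Ioo x z, ∀ s ∈ Icc x z, φ s ≤ φ m := by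
    obtain ⟨m, hm, hmle⟩ := isCompact_Icc.exists_isMaxOn (nonempty_Icc.2 (hxy.trans hyz).le)
      (hφ.mono fun s (hs : s ∈ Icc x z) => hx.trans_le hs.1)
    rcases hm.1.eq_or_lt with rfl | h1
    · exact ⟨y, ⟨hxy, hyz⟩, fun s hs => (hmle hs).trans ((le_max_left _ _).trans hmax)⟩
    rcases hm.2.eq_or_lt with rfl | h2
    · exact ⟨y, ⟨hxy, hyz⟩, fun s hs => (hmle hs).trans ((le_max_right _ _).trans hmax)⟩
    exact ⟨m, ⟨h1, h2⟩, fun s hs => hmle hs⟩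
  have hm0 : 0 < m := hx.trans hm.1
  obtain ⟨η, hη, H⟩ := h3 m hm0
  -- Otherwise φ would be constant just to the left of its maximum point m, giving three equal
  -- values near m; the same holds on the right.
  obtain ⟨x', hx', hφx'⟩ : ∃ x' ∈ Ioo (max x (m - η)) m, φ x' < φ m := by
    by_contra! hge
    have heq : ∀ s ∈ Ioo (max x (m - η)) m, φ s = φ m := fun s hs => le_antisymm
      (hmle s ⟨(max_lt_iff.1 hs.1).1.le, (hs.2.trans hm.2).le⟩) (hge s hs)
    obtain ⟨r, hr1, hr2⟩ := exists_between (max_lt hm.1 (sub_lt_self m hη))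
    obtain ⟨s, hs1, hs2⟩ := exists_between hr2
    have hs : s ∈ Ioo (max x (m - η)) m := ⟨hr1.trans hs1, hs2⟩
    have := (max_lt_iff.1 hs.1).2
    exact H r s m (hx.trans (max_lt_iff.1 hr1).1) hs1 hs2 (abs_lt.2 ⟨by linarith, by linarith⟩)
      (by simpa using hη) ((heq r ⟨hr1, hr2⟩).trans (heq s hs).symm) (heq s hs)
  obtain ⟨z', hz', hφz'⟩ : ∃ z' ∈ Ioo m (min z (m + η)), φ z' < φ m := by
    by_contra! hge
    have heq : ∀ s ∈ Ioo m (min z (m + η)), φ s = φ m := fun s hs => le_antisymm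
      (hmle s ⟨(hm.1.trans hs.1).le, (lt_min_iff.1 hs.2).1.le⟩) (hge s hs)
    obtain ⟨r, hr1, hr2⟩ := exists_between (lt_min hm.2 (lt_add_of_pos_right m hη))
    obtain ⟨s, hs1, hs2⟩ := exists_between hr1
    have hs : s ∈ Ioo m (min z (m + η)) := ⟨hs1, hs2.trans hr2⟩
    have := (lt_min_iff.1 hr2).2
    exact H m s r hm0 hs1 hs2 (abs_lt.2 ⟨by linarith, by linarith⟩)
      (abs_lt.2 ⟨by linarith, by linarith⟩) (heq s hs).symm
      ((heq s hs).trans (heq r ⟨hr1, hr2⟩).symm)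
  -- A level just below φ(m) is crossed on both sides of m, within η of it, and once more to the
  -- left of x' because φ blows up at 0.
  obtain ⟨l, hl1, hl2⟩ := exists_between (max_lt hφx' hφz')
  have hx'0 : 0 < x' := hx.trans (max_lt_iff.1 hx'.1).1
  obtain ⟨w, hw1, hw2⟩ : ∃ w ∈ Ioo 0 x', l < φ w := by
    have hev : ∀ᶠ w in 𝓝[>] (0 : ℝ), w ∈ Ioo 0 x' := Ioo_mem_nhdsGT hx'0
    exact (hev.and (h0.eventually_gt_atTop l)).exists
  have hcont : ∀ {r s : ℝ}, 0 < r → ContinuousOn φ (Icc r s) :=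
    fun hr => hφ.mono fun t ht => hr.trans_le ht.1
  obtain ⟨x₁, hx₁, e₁⟩ := intermediate_value_Icc' hw1.2.le (hcont hw1.1)
    (show l ∈ Icc (φ x') (φ w) from ⟨((le_max_left _ _).trans_lt hl1).le, hw2.le⟩)
  obtain ⟨x₂, hx₂, e₂⟩ := intermediate_value_Icc hx'.2.le (hcont hx'0)
    (show l ∈ Icc (φ x') (φ m) from ⟨((le_max_left _ _).trans_lt hl1).le, hl2.le⟩)
  obtain ⟨x₃, hx₃, e₃⟩ := intermediate_value_Icc' hz'.1.le (hcont hm0)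
    (show l ∈ Icc (φ z') (φ m) from ⟨((le_max_right _ _).trans_lt hl1).le, hl2.le⟩)
  have hlx' : φ x' < l := (le_max_left _ _).trans_lt hl1
  have n₁ : x₁ < x' := lt_of_le_of_ne hx₁.2 fun h => by rw [h] at e₁; linarith
  have n₂ : x₂ < m := lt_of_le_of_ne hx₂.2 fun h => by rw [h] at e₂; linarith
  have := (max_lt_iff.1 hx'.1).2
  have := (lt_min_iff.1 hz'.2).2
  exact H x₁ x₂ x₃ (hw1.1.trans_le hx₁.1) (n₁.trans_le hx₂.1) (n₂.trans_le hx₃.1)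
    (abs_lt.2 ⟨by linarith [hx₂.1], by linarith⟩)
    (abs_lt.2 ⟨by linarith [hx₃.1], by linarith [hx₃.2]⟩) (e₁.trans e₂.symm) (e₂.trans e₃.symm)

lemma exists_forall_le_of_tendsto {φ : ℝ → ℝ} (hφ : ContinuousOn φ (Ioi 0))
    (h0 : Tendsto φ (𝓝[>] 0) atTop) (htop : Tendsto φ atTop (𝓝 0)) {y : ℝ} (hy : 0 < y)
    (hneg : φ y < 0) : ∃ ξ₀ > 0, ∀ ξ, 0 < ξ → φ ξ₀ ≤ φ ξ := by
  obtain ⟨l, hl, hl'⟩ := mem_nhdsGT_iff_exists_Ioo_subset.1 (h0.eventually_gt_atTop (φ y))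
  obtain ⟨R, hR⟩ := eventually_atTop.1 (htop.eventually_const_lt hneg)
  have hl0 : 0 < l := hl
  have hmem : y ∈ Icc (min l y) (max R y) := ⟨min_le_right _ _, le_max_right _ _⟩
  have hpos : 0 < min l y := lt_min hl0 hy
  obtain ⟨ξ₀, h₀, hmin⟩ := isCompact_Icc.exists_isMinOn ⟨y, hmem⟩
    (hφ.mono fun s (hs : s ∈ Icc (min l y) (max R y)) => hpos.trans_le hs.1)
  refine ⟨ξ₀, hpos.trans_le h₀.1, fun ξ hξ => ?_⟩
  by_cases hin : ξ ∈ Icc (min l y) (max R y)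
  · exact hmin hin
  · refine (hmin hmem).trans ?_
    rw [mem_Icc, not_and_or, not_le, not_le] at hin
    rcases hin with h | h
    · exact (hl' ⟨hξ, h.trans_le (min_le_left _ _)⟩ : φ y < φ ξ).le
    · exact (hR ξ ((le_max_left _ _).trans h.le)).le

/-! ### The solution curve. -/

theorem mainTheorem3 (T a c : ℝ) (hT : 0 < T) (ha : 0 < a) (hc : c ≠ 0)
    (e : ℝ → ℝ) (he : Continuous e) (heT : Function.Periodic e T)
    (he0 : ∫ t in (0 : ℝ)..T, e t = 0)
    (h2 : a * (3 ^ 5 / 5 ^ 5) < (2 * Real.pi / T) ^ 2)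
    (h3 : Real.sqrt (3 * T) * normL2 T e / |c| < 1) :
    (∀ ξ : ℝ, 0 < ξ → ∃! p : (ℝ → ℝ) × ℝ,
      IsPositivePeriodicSolution T c a e p.2 p.1 ∧ periodAverage T p.1 = ξ) ∧
    ∃ φ : ℝ → ℝ,
      solutionCurve T c a e = Set.graphOn φ (Set.Ioi 0) ∧
      (∀ ψ : ℝ → ℝ, solutionCurve T c a e = Set.graphOn ψ (Set.Ioi 0) →
        Set.EqOn ψ φ (Set.Ioi 0)) ∧
      ContinuousOn φ (Set.Ioi 0) ∧
      (∃ ξ₀ : ℝ, 0 < ξ₀ ∧ φ ξ₀ < 0 ∧ (∀ ξ : ℝ, 0 < ξ → φ ξ₀ ≤ φ ξ) ∧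
        StrictAntiOn φ (Set.Ioo 0 ξ₀) ∧ StrictMonoOn φ (Set.Ioi ξ₀)) ∧
      Filter.Tendsto φ (nhdsWithin 0 (Set.Ioi 0)) Filter.atTop ∧
      Filter.Tendsto φ Filter.atTop (nhds 0) := by
  have hS : 3 * T * ∫ t in (0 : ℝ)..T, e t ^ 2 < c ^ 2 := by
    have hS0 : 0 ≤ ∫ t in (0 : ℝ)..T, e t ^ 2 := integral_nonneg hT.le fun t _ => sq_nonneg _
    rw [div_lt_one (abs_pos.2 hc), normL2, ← Real.sqrt_mul (by positivity),
      ← Real.sqrt_sq_eq_abs] at h3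
    exact (Real.sqrt_lt_sqrt_iff (by positivity)).1 h3
  -- Room strictly below ω is needed, as the tangent in Poincaré's inequality must stay finite on
  -- closed half periods.
  obtain ⟨k, hk1, hk2⟩ := exists_between
    ((Real.sqrt_lt' (show 0 < 2 * Real.pi / T by positivity)).2 h2)
  have hk : 0 ≤ k := (Real.sqrt_nonneg _).trans hk1.le
  have hkT : k * T < 2 * Real.pi := (lt_div_iff₀ hT).1 hk2
  have hak : a * (3 ^ 5 / 5 ^ 5) < k ^ 2 :=
    (Real.sqrt_lt' ((Real.sqrt_nonneg _).trans_lt hk1)).1 hk1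
  have hLip := fun {p : ℝ} (q : ℝ) (hp : 0 < p) =>
    exists_forall_abs_sub_le q hT hc ha hk hkT hak he he0 hp
  have huniq : ∀ μ₁ u₁ μ₂ u₂, IsPositivePeriodicSolution T c a e μ₁ u₁ →
      IsPositivePeriodicSolution T c a e μ₂ u₂ → periodAverage T u₁ = periodAverage T u₂ →
      u₁ = u₂ ∧ μ₁ = μ₂ := fun μ₁ u₁ μ₂ u₂ h₁ h₂ hav => by
    obtain ⟨M, -, H⟩ := hLip (periodAverage T u₁) (h₁.periodAverage_pos hT)
    have := H μ₁ u₁ μ₂ u₂ h₁ h₂ (by simp) (by simp [hav])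
    rw [hav, sub_self, abs_zero, mul_zero] at this
    exact ⟨funext fun t => sub_eq_zero.1 (abs_nonpos_iff.1 (this.1 t)),
      sub_eq_zero.1 (abs_nonpos_iff.1 this.2)⟩
  have hex : ∀ ξ : ℝ, ∃ (μ : ℝ) (u : ℝ → ℝ), 0 < ξ →
      IsPositivePeriodicSolution T c a e μ u ∧ periodAverage T u = ξ := fun ξ => by
    by_cases hξ : 0 < ξ
    · obtain ⟨μ, u, h⟩ := exists_isPositivePeriodicSolution hT hc ha hk hkT hak he heT hξ
      exact ⟨μ, u, fun _ => h⟩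
    · exact ⟨0, 0, fun h => absurd h hξ⟩
  choose φ u hφ using hex
  have hsol : ∀ {ξ : ℝ}, 0 < ξ → IsPositivePeriodicSolution T c a e (φ ξ) (u ξ) :=
    fun hξ => (hφ _ hξ).1
  have hav : ∀ {ξ : ℝ}, 0 < ξ → periodAverage T (u ξ) = ξ := fun hξ => (hφ _ hξ).2
  have hcurve : solutionCurve T c a e = graphOn φ (Ioi 0) := by
    ext ⟨ξ, μ⟩
    simp only [solutionCurve, mem_ofPred_eq, mem_graphOn, mem_Ioi]
    constructor
    · rintro ⟨v, hv, rfl⟩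
      have hpos := hv.periodAverage_pos hT
      exact ⟨hpos, (huniq _ _ _ _ (hsol hpos) hv (hav hpos)).2⟩
    · rintro ⟨hξ, rfl⟩
      exact ⟨u ξ, hsol hξ, hav hξ⟩
  have hlip : ∀ {p : ℝ} (q : ℝ), 0 < p → ∃ M, 0 ≤ M ∧ ∀ x ∈ Icc p q, ∀ y ∈ Icc p q,
      (∀ t, |u x t - u y t| ≤ M * |x - y|) ∧ |φ x - φ y| ≤ M * |x - y| := fun {p} q hp => by
    obtain ⟨M, hM, H⟩ := hLip q hp
    refine ⟨M, hM, fun x hx y hy => ?_⟩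
    have hx0 := hp.trans_le hx.1
    have hy0 := hp.trans_le hy.1
    simpa only [hav hx0, hav hy0] using H (φ x) (u x) (φ y) (u y) (hsol hx0) (hsol hy0)
      (by rwa [hav hx0]) (by rwa [hav hy0])
  have hcont : ContinuousOn φ (Ioi 0) := by
    intro x hx
    have hx0 : 0 < x := hx
    obtain ⟨M, hM, H⟩ := hlip (p := x / 2) (2 * x) (by positivity)
    have hnhds : Icc (x / 2) (2 * x) ∈ 𝓝 x := Icc_mem_nhds (by linarith) (by linarith)
    have hLW : LipschitzOnWith (Real.toNNReal M) φ (Icc (x / 2) (2 * x)) :=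
      LipschitzOnWith.of_dist_le_mul fun y hy z hz => by
        rw [Real.coe_toNNReal _ hM]
        exact (H y hy z hz).2
    exact (hLW.continuousOn.continuousAt hnhds).continuousWithinAt
  have hzero : Tendsto φ (𝓝[>] 0) atTop := by
    refine tendsto_atTop_mono' _ ?_ ((tendsto_atTop_add_const_right _ (-1)
      tendsto_inv_nhdsGT_zero).const_mul_atTop ha)
    filter_upwards [self_mem_nhdsWithin] with ξ hξ
    have := (hsol hξ).mul_inv_periodAverage_sub_one_le hT ha he he0
    rwa [hav hξ] at this
  have hge : ∀ {ξ : ℝ}, 0 < ξ → ∀ t, ξ - 1 ≤ u ξ t := fun {ξ} hξ t => by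
    have := (abs_le.1 ((hsol hξ).abs_sub_periodAverage_le_one hT hc ha he hS t)).1
    rw [hav hξ] at this
    linarith
  have hneg : ∀ {ξ : ℝ}, 2 < ξ → φ ξ < 0 := fun {ξ} hξ =>
    (hsol (by linarith)).neg_of_forall_one_lt hT ha he he0 fun t => by
      linarith [hge (show 0 < ξ by linarith) t]
  have htop : Tendsto φ atTop (𝓝 0) := by
    have hl : Tendsto (fun ξ : ℝ => -a / (ξ + -1)) atTop (𝓝 0) :=
      (tendsto_atTop_add_const_right _ (-1) tendsto_id).const_div_atTop (-a)
    refine tendsto_of_tendsto_of_tendsto_of_le_of_le' hl tendsto_const_nhds ?_ ?_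
    · filter_upwards [eventually_gt_atTop 2] with ξ hξ
      have hξ0 : 0 < ξ := by linarith
      refine (hsol hξ0).le_of_forall_le hT he he0 fun t => ?_
      have h1 := hge hξ0 t
      have h1' : 1 ≤ u ξ t := by linarith
      have hpos := (hsol hξ0).pos t
      rw [nonlinearity_eq hpos, neg_div, neg_le, ← neg_div]
      calc -(a * (1 - u ξ t)) / u ξ t ^ 4 ≤ a * u ξ t / u ξ t ^ 4 := by
            gcongr; nlinarith
        _ = a / u ξ t ^ 3 := by field_simp
        _ ≤ a / u ξ t ^ 1 := by gcongr; norm_num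
        _ ≤ a / (ξ + -1) := by
            rw [pow_one]
            gcongr
            · linarith
            · linarith
    · filter_upwards [eventually_gt_atTop 2] with ξ hξ using (hneg hξ).le
  have hquasi : ∀ {x y z : ℝ}, 0 < x → x < y → y < z → φ y < max (φ x) (φ z) := by
    refine fun hx hxy hyz => lt_max_of_locally_not_three hcont hzero (fun y hy => ?_) hx hxy hyz
    obtain ⟨M, hM, H⟩ := hlip (p := y / 2) (2 * y) (by positivity)
    -- Points this close to y stay in [y/2, 2y] and lie within 1/(25(M + 1)) of each other, so their
    -- solutions differ by at most 1/25.
    refine ⟨min (y / 2) (1 / (50 * (M + 1))), by positivity,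
      fun x₁ x₂ x₃ h₁ h₁₂ h₂₃ hx₂ hx₃ e₁₂ e₂₃ => ?_⟩
    have h₂ := h₁.trans h₁₂
    have h₃ := h₂.trans h₂₃
    have s₁ := hsol h₁
    have s₃ := hsol h₃
    rw [e₁₂] at s₁
    rw [← e₂₃] at s₃
    rw [lt_min_iff] at hx₂ hx₃
    have b₂ := abs_lt.1 hx₂.1
    have b₃ := abs_lt.1 hx₃.1
    have hclose : |x₃ - x₂| ≤ 1 / (25 * (M + 1)) := by
      have e1 : x₃ - x₂ = (x₃ - y) - (x₂ - y) := by ring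
      have e2 : 1 / (25 * (M + 1)) = 1 / (50 * (M + 1)) + 1 / (50 * (M + 1)) := by
        field_simp
        norm_num
      rw [e1, e2]
      exact (abs_sub _ _).trans (add_le_add hx₃.2.le hx₂.2.le)
    refine not_exists_three hT hc ha hk hkT hak he he0 hS s₁ (hsol h₂) s₃
      (by rwa [hav h₁, hav h₂]) (by rwa [hav h₂, hav h₃]) fun t => ?_
    refine ((H x₃ ⟨by linarith, by linarith⟩ x₂ ⟨by linarith, by linarith⟩).1 t).trans ?_
    calc M * |x₃ - x₂| ≤ (M + 1) * (1 / (25 * (M + 1))) := by gcongr; linarith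
      _ = 1 / 25 := by field_simp
  obtain ⟨ξ₀, hξ₀, hmin⟩ := exists_forall_le_of_tendsto hcont hzero htop
    (show (0 : ℝ) < 3 by norm_num) (hneg (by norm_num))
  refine ⟨fun ξ hξ => ⟨(u ξ, φ ξ), ⟨hsol hξ, hav hξ⟩, ?_⟩, φ, hcurve, fun ψ hψ x hx => ?_, hcont,
    ⟨ξ₀, hξ₀, (hmin 3 (by norm_num)).trans_lt (hneg (by norm_num)), hmin,
      fun x hx y hy hxy => ?_, fun x hx y hy hxy => ?_⟩, hzero, htop⟩
  · rintro ⟨v, μ⟩ ⟨hv, hvξ⟩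
    obtain ⟨h₁, h₂⟩ := huniq _ _ _ _ hv (hsol hξ) (hvξ.trans (hav hξ).symm)
    exact Prod.ext h₁ h₂
  · have : (x, ψ x) ∈ graphOn φ (Ioi 0) := by
      rw [← hcurve, hψ]
      exact mem_graphOn.2 ⟨hx, rfl⟩
    exact (mem_graphOn.1 this).2.symm
  -- Quasiconvexity against the minimum point ξ₀ gives monotonicity: the alternative would put a
  -- value below the minimum.
  · rcases lt_max_iff.1 (hquasi hx.1 hxy hy.2) with h | h
    · exact h
    · exact absurd h (not_lt.2 (hmin y hy.1))
  · rcases lt_max_iff.1 (hquasi hξ₀ hx hxy) with h | h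
    · exact absurd h (not_lt.2 (hmin x (hξ₀.trans hx)))
    · exact h
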